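/- Let $X$ be a (real) Banach space, $0<p\le 1$, $0<\alpha\le 1$ and $R>1$. Let $\mathcal M\subset X$ satisfy $0\in\mathcal M$ and $t\mathcal M\subset\mathcal M$ for all $t\ge 0$, and endow $\mathcal M$ with the snowflake metric $d(x,y)=\|x-y\|^{\alpha}$ and the base point $0$. Put $B_{\mathcal M}=\{x\in\mathcal M: d(0,x)\le 1\}$ and $\mathcal M_{(1,R]}=\{x\in\mathcal M: 1<d(0,x)\le R\}$. For a metric space $(\mathcal N,d)$ with base point $o$, let $\mathcal F_p(\mathcal N)$ denote the Lipschitz free $p$-space over $\mathcal N$: the completion of the linear span of the evaluations $\delta(x)$, $x\in \mathcal N$ (with $\delta(o)=0$), under the $p$-norm $$\|\mu\|=\inf\Big\{\Big(\sum_{j=1}^n |a_j|^p\, d(x_j,y_j)^p\Big)^{1/p}:\ \mu=\sum_{j=1}^n a_j\,(\delta(x_j)-\delta(y_j))\Big\}.$$ For a $p$-Banach space $E$ let $\ell_p(E)$ be the space of sequences $(x_n)$ in $E$ with $p$-norm $\big(\sum_n\|x_n\|^p\big)^{1/p}<\infty$. Write $E\simeq F$ if there are mutually inverse bounded linear maps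 between $E$ and $F$. Then $\mathcal F_p(\mathcal M)\simeq\mathcal F_p(B_{\mathcal M})$, and, if $\mathcal M\neq\{0\}$, then $$\mathcal F_p(\mathcal M)\simeq \mathcal F_p(B_{\mathcal M})\simeq \mathcal F_p(\mathcal M\setminus B_{\mathcal M})\simeq \ell_p\big(\mathcal F_p(\mathcal M_{(1,R]})\big),$$ where the base point of $\mathcal M$ and $B_{\mathcal M}$ is $0$ and the base points of $\mathcal M\setminus B_{\mathcal M}$ and of $\mathcal M_{(1,R]}$ may be chosen arbitrarily. -/

import Mathlib

noncomputable section

/-- A `p`-Banach space `E`. Its complete `p`-norm `‖·‖_p` is recorded through the `p`-th power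
`‖x‖ = ‖x‖_p ^ p`, which is subadditive (so that `‖x - y‖` is a metric and `E` is a
`NormedAddCommGroup`) and satisfies `‖c • x‖ = |c| ^ p * ‖x‖`. -/
class PBanachSpace (p : ℝ) (E : Type*) [NormedAddCommGroup E] [Module ℝ E] : Prop where
  norm_smul_eq : ∀ (c : ℝ) (x : E), ‖c • x‖ = |c| ^ p * ‖x‖
  complete : CompleteSpace E

/-- The `p`-norm (the quasi-norm) of a vector of a `p`-Banach space. -/
def pNorm (p : ℝ) {E : Type*} [NormedAddCommGroup E] [Module ℝ E] [PBanachSpace p E] (x : E) : ℝ :=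
  ‖x‖ ^ (1 / p)

/-- A linear map between `p`-Banach spaces is bounded. -/
def IsBoundedOp (p : ℝ) {E F : Type*} [NormedAddCommGroup E] [Module ℝ E] [PBanachSpace p E]
    [NormedAddCommGroup F] [Module ℝ F] [PBanachSpace p F] (S : E →ₗ[ℝ] F) : Prop :=
  ∃ C : ℝ, ∀ x : E, pNorm p (S x) ≤ C * pNorm p x

/-- Two `p`-Banach spaces are isomorphic: there are mutually inverse bounded linear maps. -/
def Isomorphic (p : ℝ) (E F : Type*) [NormedAddCommGroup E] [Module ℝ E] [PBanachSpace p E]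
    [NormedAddCommGroup F] [Module ℝ F] [PBanachSpace p F] : Prop :=
  ∃ (S : E →ₗ[ℝ] F) (T : F →ₗ[ℝ] E),
    T ∘ₗ S = LinearMap.id ∧ S ∘ₗ T = LinearMap.id ∧ IsBoundedOp p S ∧ IsBoundedOp p T

/-! ### The `ℓ_p`-sum of countably many copies of a `p`-Banach space -/

/-- `ℓ_p(E)`: the sequences `x` in `E` with `∑ n, ‖x n‖_p ^ p = ∑ n, ‖x n‖ < ∞`; the `p`-th power
of the `p`-norm of `x` is `∑ n, ‖x n‖` (see `SeqLp.norm_eq` below). -/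
def SeqLp (_p : ℝ) (E : Type*) [NormedAddCommGroup E] : Type _ := lp (fun _ : ℕ => E) 1

namespace SeqLp

instance (p : ℝ) (E : Type*) [NormedAddCommGroup E] : NormedAddCommGroup (SeqLp p E) :=
  inferInstanceAs (NormedAddCommGroup (lp (fun _ : ℕ => E) 1))

/-- The terms of a sequence in `ℓ_p(E)`. -/
def coord {p : ℝ} {E : Type*} [NormedAddCommGroup E] (x : SeqLp p E) : ℕ → E := x.1

theorem mem_iff {E : Type*} [NormedAddCommGroup E] (f : ℕ → E) :
    Memℓp f 1 ↔ Summable fun n => ‖f n‖ := by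
  rw [memℓp_gen_iff (by simp)]
  simp

theorem norm_eq {p : ℝ} {E : Type*} [NormedAddCommGroup E] (x : SeqLp p E) :
    ‖x‖ = ∑' n, ‖coord x n‖ := by
  have h := lp.norm_eq_tsum_rpow (p := 1) (E := fun _ : ℕ => E) (by simp) x
  simp only [ENNReal.toReal_one, Real.rpow_one, div_one] at h
  exact h

theorem smul_mem {p : ℝ} {E : Type*} [NormedAddCommGroup E] [Module ℝ E] [PBanachSpace p E]
    (c : ℝ) (x : SeqLp p E) : Memℓp (fun n => c • coord x n) 1 := by
  rw [mem_iff]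
  simp only [PBanachSpace.norm_smul_eq (p := p)]
  exact ((mem_iff _).1 x.2).mul_left _

/-- Scalar multiplication is coordinatewise. -/
instance (p : ℝ) (E : Type*) [NormedAddCommGroup E] [Module ℝ E] [PBanachSpace p E] :
    Module ℝ (SeqLp p E) where
  smul c x := ⟨fun n => c • coord x n, smul_mem c x⟩
  one_smul x := Subtype.ext (funext fun n => one_smul ℝ (coord x n))
  mul_smul a b x := Subtype.ext (funext fun n => mul_smul a b (coord x n))
  smul_zero a := Subtype.ext (funext fun _ => smul_zero a)
  smul_add a x y := Subtype.ext (funext fun n => smul_add a (coord x n) (coord y n))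
  add_smul a b x := Subtype.ext (funext fun n => add_smul a b (coord x n))
  zero_smul x := Subtype.ext (funext fun n => zero_smul ℝ (coord x n))

instance (p : ℝ) (E : Type*) [NormedAddCommGroup E] [Module ℝ E] [PBanachSpace p E] :
    PBanachSpace p (SeqLp p E) where
  norm_smul_eq c x := by
    have h : ∀ n, ‖coord (c • x) n‖ = |c| ^ p * ‖coord x n‖ :=
      fun n => PBanachSpace.norm_smul_eq (p := p) c (coord x n)
    rw [norm_eq, norm_eq, ← tsum_mul_left]
    exact tsum_congr h
  complete := by
    have : CompleteSpace E := PBanachSpace.complete p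
    exact inferInstanceAs (CompleteSpace (lp (fun _ : ℕ => E) 1))

end SeqLp

/-! ### The Lipschitz free `p`-space over a pointed metric space -/

/-- A representation of the finitely supported function `m` on `Y` as
`∑ⱼ aⱼ (δ(xⱼ) - δ(yⱼ)) + c δ(o)`; the list consists of the triples `(aⱼ, xⱼ, yⱼ)`. -/
def IsMolecularRep {Y : Type*} (o : Y) (m : Y →₀ ℝ) (l : List (ℝ × Y × Y)) : Prop :=
  ∃ c : ℝ, m = (l.map fun t => t.1 • (Finsupp.single t.2.1 1 - Finsupp.single t.2.2 1)).sum
    + Finsupp.single o c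

/-- The cost `∑ⱼ |aⱼ| ^ p d(xⱼ, yⱼ) ^ p` of a representation. -/
def molecularCost (p : ℝ) {Y : Type*} [MetricSpace Y] (l : List (ℝ × Y × Y)) : ℝ :=
  (l.map fun t => |t.1| ^ p * dist t.2.1 t.2.2 ^ p).sum

/-- The `p`-th power of the free `p`-norm of `∑ₓ m(x) δ(x)`, where `δ(o) = 0`: the infimum of
`∑ⱼ |bⱼ| ^ p` over all representations of this element as a combination
`∑ⱼ bⱼ (δ(xⱼ) - δ(yⱼ)) / d(xⱼ, yⱼ)` (with `bⱼ = aⱼ d(xⱼ, yⱼ)`). Equivalently, this is the largest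
`p`-seminorm for which `δ` is `1`-Lipschitz and `δ(o) = 0`. -/
def freeGauge (p : ℝ) {Y : Type*} [MetricSpace Y] (o : Y) (m : Y →₀ ℝ) : ℝ :=
  sInf {s | ∃ l : List (ℝ × Y × Y), IsMolecularRep o m l ∧ s = molecularCost p l}

section Gauge

theorem molecularCost_nonneg (p : ℝ) {Y : Type*} [MetricSpace Y] (l : List (ℝ × Y × Y)) :
    0 ≤ molecularCost p l := by
  refine List.sum_nonneg fun s hs => ?_
  obtain ⟨t, -, rfl⟩ := List.mem_map.1 hs
  positivity

theorem exists_isMolecularRep {Y : Type*} (o : Y) (m : Y →₀ ℝ) :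
    ∃ l : List (ℝ × Y × Y), IsMolecularRep o m l := by
  induction m using Finsupp.induction_linear with
  | zero => exact ⟨[], 0, by simp⟩
  | add f g hf hg =>
    obtain ⟨l, c, hl⟩ := hf
    obtain ⟨l', c', hl'⟩ := hg
    refine ⟨l ++ l', c + c', ?_⟩
    rw [List.map_append, List.sum_append, Finsupp.single_add]
    nth_rewrite 1 [hl]
    nth_rewrite 1 [hl']
    abel
  | single x a => exact ⟨[(a, x, o)], a, by simp [smul_sub]⟩

theorem freeGauge_nonneg (p : ℝ) {Y : Type*} [MetricSpace Y] (o : Y) (m : Y →₀ ℝ) :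
    0 ≤ freeGauge p o m := by
  refine Real.sInf_nonneg ?_
  rintro _ ⟨l, -, rfl⟩
  exact molecularCost_nonneg p l

theorem freeGauge_le (p : ℝ) {Y : Type*} [MetricSpace Y] {o : Y} {m : Y →₀ ℝ}
    {l : List (ℝ × Y × Y)} (h : IsMolecularRep o m l) : freeGauge p o m ≤ molecularCost p l := by
  refine csInf_le ⟨0, ?_⟩ ⟨l, h, rfl⟩
  rintro _ ⟨l, -, rfl⟩
  exact molecularCost_nonneg p l

theorem le_freeGauge (p : ℝ) {Y : Type*} [MetricSpace Y] {o : Y} {m : Y →₀ ℝ} {b : ℝ}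
    (h : ∀ l, IsMolecularRep o m l → b ≤ molecularCost p l) : b ≤ freeGauge p o m := by
  obtain ⟨l, hl⟩ := exists_isMolecularRep o m
  refine le_csInf ⟨_, l, hl, rfl⟩ ?_
  rintro _ ⟨l, hl, rfl⟩
  exact h l hl

theorem freeGauge_add_le (p : ℝ) {Y : Type*} [MetricSpace Y] (o : Y) (m m' : Y →₀ ℝ) :
    freeGauge p o (m + m') ≤ freeGauge p o m + freeGauge p o m' := by
  rw [← sub_le_iff_le_add]
  refine le_freeGauge p fun l hl => ?_
  rw [sub_le_comm]
  refine le_freeGauge p fun l' hl' => ?_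
  rw [sub_le_iff_le_add]
  obtain ⟨c, hc⟩ := hl
  obtain ⟨c', hc'⟩ := hl'
  have h : IsMolecularRep o (m + m') (l ++ l') := by
    refine ⟨c + c', ?_⟩
    rw [List.map_append, List.sum_append, Finsupp.single_add, hc, hc']
    abel
  refine (freeGauge_le p h).trans_eq ?_
  rw [molecularCost, List.map_append, List.sum_append, add_comm]
  rfl

theorem freeGauge_zero (p : ℝ) {Y : Type*} [MetricSpace Y] (o : Y) :
    freeGauge p o (0 : Y →₀ ℝ) = 0 := by
  refine le_antisymm ?_ (freeGauge_nonneg p o 0)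
  have h : IsMolecularRep o (0 : Y →₀ ℝ) [] := ⟨0, by simp⟩
  simpa [molecularCost] using freeGauge_le p h

theorem freeGauge_smul_le (p : ℝ) {Y : Type*} [MetricSpace Y] (o : Y) (c : ℝ) (hc : c ≠ 0)
    (m : Y →₀ ℝ) : freeGauge p o (c • m) ≤ |c| ^ p * freeGauge p o m := by
  have hpos : 0 < |c| ^ p := Real.rpow_pos_of_pos (abs_pos.2 hc) p
  rw [← div_le_iff₀' hpos]
  refine le_freeGauge p fun l hl => ?_
  rw [div_le_iff₀' hpos]
  obtain ⟨d, hd⟩ := hl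
  have h : IsMolecularRep o (c • m) (l.map fun t => (c * t.1, t.2)) := by
    refine ⟨c * d, ?_⟩
    rw [hd, smul_add, List.smul_sum, List.map_map, List.map_map, Finsupp.smul_single, smul_eq_mul]
    simp only [Function.comp_def, mul_smul]
  refine (freeGauge_le p h).trans_eq ?_
  rw [molecularCost, molecularCost, ← List.sum_map_mul_left, List.map_map]
  simp only [Function.comp_def, abs_mul, Real.mul_rpow (abs_nonneg _) (abs_nonneg _), mul_assoc]

theorem freeGauge_smul (p : ℝ) {Y : Type*} [MetricSpace Y] (o : Y) (c : ℝ) (hc : c ≠ 0)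
    (m : Y →₀ ℝ) : freeGauge p o (c • m) = |c| ^ p * freeGauge p o m := by
  refine le_antisymm (freeGauge_smul_le p o c hc m) ?_
  have hpos : 0 < |c| ^ p := Real.rpow_pos_of_pos (abs_pos.2 hc) p
  have h := freeGauge_smul_le p o c⁻¹ (inv_ne_zero hc) (c • m)
  rwa [inv_smul_smul₀ hc, abs_inv, Real.inv_rpow (abs_nonneg c), ← div_eq_inv_mul,
    le_div_iff₀' hpos] at h

end Gauge

/-- The finite combinations of point evaluations `δ(x)`, `x ∈ Y`, with the free `p`-seminorm
(which vanishes at `δ(o)`). -/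
def PreLipFree (_p : ℝ) (Y : Type*) (_o : Y) : Type _ := Y →₀ ℝ

namespace PreLipFree

instance (p : ℝ) (Y : Type*) (o : Y) : AddCommGroup (PreLipFree p Y o) :=
  inferInstanceAs (AddCommGroup (Y →₀ ℝ))

instance (p : ℝ) (Y : Type*) (o : Y) : Module ℝ (PreLipFree p Y o) :=
  inferInstanceAs (Module ℝ (Y →₀ ℝ))

instance (p : ℝ) (Y : Type*) [MetricSpace Y] (o : Y) : SeminormedAddCommGroup (PreLipFree p Y o) :=
  AddGroupSeminorm.toSeminormedAddCommGroup
    { toFun := fun m : Y →₀ ℝ => freeGauge p o m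
      map_zero' := freeGauge_zero p o
      add_le' := freeGauge_add_le p o
      neg' := fun m : Y →₀ ℝ => by
        have h := freeGauge_smul p o (-1) (by norm_num) m
        rw [neg_one_smul, abs_neg, abs_one, Real.one_rpow, one_mul] at h
        exact h }

theorem norm_def (p : ℝ) (Y : Type*) [MetricSpace Y] (o : Y) (m : PreLipFree p Y o) :
    ‖m‖ = freeGauge p o (m : Y →₀ ℝ) := rfl

theorem norm_smul_eq (p : ℝ) [hp : Fact (0 < p)] (Y : Type*) [MetricSpace Y] (o : Y) (c : ℝ)
    (m : PreLipFree p Y o) : ‖c • m‖ = |c| ^ p * ‖m‖ := by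
  by_cases hc : c = 0
  · subst hc
    rw [zero_smul, norm_zero, abs_zero, Real.zero_rpow hp.out.ne', zero_mul]
  · exact freeGauge_smul p o c hc m

instance (p : ℝ) [hp : Fact (0 < p)] (Y : Type*) [MetricSpace Y] (o : Y) :
    UniformContinuousConstSMul ℝ (PreLipFree p Y o) where
  uniformContinuous_const_smul c := by
    refine (LipschitzWith.of_dist_le_mul (K := Real.toNNReal (|c| ^ p))
      fun x y => ?_).uniformContinuous
    rw [dist_eq_norm, dist_eq_norm, ← smul_sub, norm_smul_eq, Real.coe_toNNReal _ (by positivity)]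

end PreLipFree

theorem completion_norm_smul (p : ℝ) [Fact (0 < p)] (Y : Type*) [MetricSpace Y] (o : Y) (c : ℝ)
    (x : UniformSpace.Completion (PreLipFree p Y o)) : ‖c • x‖ = |c| ^ p * ‖x‖ := by
  refine UniformSpace.Completion.induction_on x ?_ fun m => ?_
  · exact isClosed_eq (continuous_norm.comp (continuous_const_smul c))
      (continuous_const.mul continuous_norm)
  · rw [← UniformSpace.Completion.coe_smul, UniformSpace.Completion.norm_coe,
      UniformSpace.Completion.norm_coe, PreLipFree.norm_smul_eq]

/-- The Lipschitz free `p`-space `F_p(Y)` over the metric space `Y` with base point `o`: the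
(separated) completion of the span of the point evaluations in the free `p`-norm. -/
def LipFree (p : ℝ) (Y : Type*) [MetricSpace Y] (o : Y) : Type _ :=
  UniformSpace.Completion (PreLipFree p Y o)

namespace LipFree

instance (p : ℝ) (Y : Type*) [MetricSpace Y] (o : Y) : NormedAddCommGroup (LipFree p Y o) :=
  inferInstanceAs (NormedAddCommGroup (UniformSpace.Completion (PreLipFree p Y o)))

instance (p : ℝ) [Fact (0 < p)] (Y : Type*) [MetricSpace Y] (o : Y) : Module ℝ (LipFree p Y o) :=
  inferInstanceAs (Module ℝ (UniformSpace.Completion (PreLipFree p Y o)))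

instance (p : ℝ) [Fact (0 < p)] (Y : Type*) [MetricSpace Y] (o : Y) :
    PBanachSpace p (LipFree p Y o) where
  norm_smul_eq := completion_norm_smul p Y o
  complete := inferInstanceAs (CompleteSpace (UniformSpace.Completion (PreLipFree p Y o)))

end LipFree

/-! ### Balls and annuli in a pointed metric space -/

/-- The unit ball `B_Y = {x ∈ Y : d(o, x) ≤ 1}` about the base point `o`. -/
def unitBall {Y : Type*} [MetricSpace Y] (o : Y) : Set Y := {x | dist o x ≤ 1}

/-- The annulus `Y_A = {x ∈ Y : d(o, x) ∈ A}` about the base point `o`. -/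
def annulus {Y : Type*} [MetricSpace Y] (o : Y) (A : Set ℝ) : Set Y := {x | dist o x ∈ A}

theorem mem_unitBall_self {Y : Type*} [MetricSpace Y] (o : Y) : o ∈ unitBall o := by
  simp [unitBall]

/-- The point `0` of the snowflake `(M, ‖·‖ ^ α)` of a subset `M ∋ 0` of a normed space, used as
its base point. -/
def snowZero {X : Type*} [NormedAddCommGroup X] {M : Set X} (h0 : (0 : X) ∈ M) {α : ℝ}
    (hα₀ : 0 < α) (hα₁ : α ≤ 1) : Metric.Snowflaking M α hα₀ hα₁ :=
  Metric.Snowflaking.toSnowflaking ⟨0, h0⟩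

end

/-! Norms are recorded as `p`-th powers, so every estimate reads `‖f x - f y‖ ≤ K * dist x y ^ p`,
and the `ℓ_p`-norm is a plain sum. By the universal property (`exists_lift`), such a map into a
`p`-Banach space induces an operator on the free space, so everything reduces to constructing
Lipschitz maps.

Let A be the annulus of radii in (1, R] and Z = ℓ_p(F_p(A)). In the snowflake of a cone, scaling by
s ^ (1/α) multiplies distances by s. This gives a dilation group (`IsDilation`), and the rest of the
geometry uses only its axioms. The free spaces over the whole space, the ball and the complement of
the ball are each isomorphic to Z by Pełczyński's decomposition method
(`IsComplementedIn.nonempty_equiv`): it suffices that each is complemented in Z and that Z is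
complemented in each.

Complemented in Z: a partition of unity in log d(0, x) cuts δ(x) into at most two pieces, each
dilated back into A (`isComplementedIn_seqLp_annulus`). This handles the whole space. The free
spaces over the ball and its complement are complemented in the free space over the whole space, by
a radial retraction and by a cut-off radial retraction respectively.

Containing Z: dilates of A with ratios at least 4R are so far apart that the dilated projections
onto their free spaces have disjoint supports (`isComplementedIn_of_sparse`). Such dilates can be
chosen inside the ball or inside its complement. -/

noncomputable section

open Filter Topology

/-! ### Bounded operators between `p`-Banach spaces -/

namespace PBanachSpace

theorem exists_bound {p : ℝ} (hp : 0 < p) {E F : Type*} [NormedAddCommGroup E] [Module ℝ E]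
    [PBanachSpace p E] [NormedAddCommGroup F] [Module ℝ F] [PBanachSpace p F] (T : E →L[ℝ] F) :
    ∃ K : ℝ, 0 ≤ K ∧ ∀ x, ‖T x‖ ≤ K * ‖x‖ := by
  obtain ⟨δ, hδ, h⟩ := Metric.continuous_iff.1 T.continuous 0 1 one_pos
  refine ⟨2 / δ, by positivity, fun x => ?_⟩
  rcases eq_or_ne x 0 with rfl | hx
  · simp
  have hx' : 0 < ‖x‖ := norm_pos_iff.2 hx
  -- Chosen so that `‖c • x‖ = δ / 2`.
  set c : ℝ := (δ / 2 / ‖x‖) ^ (1 / p) with hc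
  have hcp : |c| ^ p = δ / 2 / ‖x‖ := by
    rw [abs_of_nonneg (by positivity), hc, ← Real.rpow_mul (by positivity),
      one_div_mul_cancel hp.ne', Real.rpow_one]
  have h1 := h (c • x) (by
    rw [dist_zero_right, norm_smul_eq (p := p), hcp, div_mul_cancel₀ _ hx'.ne']
    linarith)
  rw [map_zero, dist_zero_right, map_smul, norm_smul_eq (p := p), hcp, div_div, div_mul_eq_mul_div,
    div_lt_one (by positivity)] at h1
  rw [div_mul_eq_mul_div, le_div_iff₀ hδ]
  linarith

theorem isBoundedOp {p : ℝ} (hp : 0 < p) {E F : Type*} [NormedAddCommGroup E] [Module ℝ E]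
    [PBanachSpace p E] [NormedAddCommGroup F] [Module ℝ F] [PBanachSpace p F] (T : E →L[ℝ] F) :
    IsBoundedOp p (T : E →ₗ[ℝ] F) := by
  obtain ⟨K, hK, h⟩ := exists_bound hp T
  refine ⟨K ^ (1 / p), fun x => ?_⟩
  rw [pNorm, pNorm, ← Real.mul_rpow hK (norm_nonneg _)]
  exact Real.rpow_le_rpow (norm_nonneg _) (h x) (by positivity)

theorem isomorphic_of_equiv {p : ℝ} (hp : 0 < p) {E F : Type*} [NormedAddCommGroup E] [Module ℝ E]
    [PBanachSpace p E] [NormedAddCommGroup F] [Module ℝ F] [PBanachSpace p F] (e : E ≃L[ℝ] F) :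
    Isomorphic p E F :=
  ⟨(e : E →L[ℝ] F), (e.symm : F →L[ℝ] E), by ext; simp, by ext; simp,
    isBoundedOp hp _, isBoundedOp hp _⟩

end PBanachSpace

/-- A linear map with a linear norm bound, as a continuous linear map. -/
def LinearMap.toCLMOfBound {E F : Type*} [SeminormedAddCommGroup E] [Module ℝ E]
    [SeminormedAddCommGroup F] [Module ℝ F] (T : E →ₗ[ℝ] F) (K : ℝ)
    (h : ∀ x, ‖T x‖ ≤ K * ‖x‖) : E →L[ℝ] F :=
  ⟨T, AddMonoidHomClass.continuous_of_bound T K h⟩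

/-! ### Operators on `ℓ_p`-sums -/

namespace SeqLp

variable {p : ℝ} {E : Type*} [NormedAddCommGroup E]

theorem ext {x y : SeqLp p E} (h : ∀ n, coord x n = coord y n) : x = y :=
  Subtype.ext (funext h)

/-- The element of `ℓ_p(E)` with prescribed terms. -/
def ofSummable (f : ℕ → E) (h : Summable fun n => ‖f n‖) : SeqLp p E := ⟨f, (mem_iff f).2 h⟩

theorem summable_norm (x : SeqLp p E) : Summable fun n => ‖coord x n‖ := (mem_iff _).1 x.2

theorem norm_coord_le (x : SeqLp p E) (n : ℕ) : ‖coord x n‖ ≤ ‖x‖ := by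
  rw [norm_eq]
  exact (summable_norm x).le_tsum n fun _ _ => norm_nonneg _

variable [Module ℝ E] [PBanachSpace p E]

/-- The coordinate map as a continuous linear map. -/
def coordL (p : ℝ) (E : Type*) [NormedAddCommGroup E] [Module ℝ E] [PBanachSpace p E] (n : ℕ) :
    SeqLp p E →L[ℝ] E :=
  LinearMap.toCLMOfBound
    { toFun := fun x => coord x n, map_add' := fun _ _ => rfl, map_smul' := fun _ _ => rfl } 1
    fun x => by rw [one_mul]; exact norm_coord_le x n

/-- The inclusion of `E` as the `n`-th summand of `ℓ_p(E)`. -/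
def single (p : ℝ) (E : Type*) [NormedAddCommGroup E] [Module ℝ E] [PBanachSpace p E] (n : ℕ) :
    E →L[ℝ] SeqLp p E :=
  LinearMap.toCLMOfBound
    { toFun := fun a => (lp.single (E := fun _ : ℕ => E) 1 n a : lp (fun _ : ℕ => E) 1)
      map_add' := fun a b => lp.single_add (E := fun _ : ℕ => E) 1 n a b
      map_smul' := fun c a => SeqLp.ext fun m => by
        change (Pi.single n (c • a) : ℕ → E) m = c • (Pi.single n a : ℕ → E) m
        rw [Pi.single_smul, Pi.smul_apply] } 1
    fun a => by
      rw [one_mul]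
      exact (lp.norm_single (E := fun _ : ℕ => E) one_pos n a).le

theorem norm_single (n : ℕ) (a : E) : ‖single p E n a‖ = ‖a‖ :=
  lp.norm_single (E := fun _ : ℕ => E) one_pos n a

@[simp] theorem coordL_single_self (n : ℕ) (a : E) : coordL p E n (single p E n a) = a :=
  Pi.single_eq_same (M := fun _ : ℕ => E) n a

theorem coordL_single_of_ne {n m : ℕ} (h : m ≠ n) (a : E) :
    coordL p E m (single p E n a) = 0 :=
  Pi.single_eq_of_ne (M := fun _ : ℕ => E) h a

theorem hasSum_single (x : SeqLp p E) : HasSum (fun n => single p E n (coord x n)) x :=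
  lp.hasSum_single (E := fun _ : ℕ => E) (p := 1) ENNReal.one_ne_top x

variable {F : Type*} [NormedAddCommGroup F] [Module ℝ F]

theorem clm_ext {S T : SeqLp p E →L[ℝ] F}
    (h : ∀ n a, S (single p E n a) = T (single p E n a)) : S = T := by
  ext x
  have h1 := (hasSum_single x).map S S.continuous
  have h2 := (hasSum_single x).map T T.continuous
  refine h1.unique ?_
  convert h2 using 1
  exact funext fun n => h n _

/-- A uniformly bounded sequence of operators `E → F` induces an operator `ℓ_p(E) → F`. -/
theorem exists_ofFamily [PBanachSpace p F] (T : ℕ → E →L[ℝ] F) {K : ℝ}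
    (hT : ∀ n a, ‖T n a‖ ≤ K * ‖a‖) :
    ∃ L : SeqLp p E →L[ℝ] F, (∀ n a, L (single p E n a) = T n a) ∧
      (∀ x, L x = ∑' n, T n (coord x n)) ∧ ∀ x, ‖L x‖ ≤ K * ‖x‖ := by
  have : CompleteSpace F := PBanachSpace.complete p
  have hs : ∀ x : SeqLp p E, Summable fun n => ‖T n (coord x n)‖ := fun x =>
    Summable.of_nonneg_of_le (fun _ => norm_nonneg _) (fun n => hT n _)
      ((summable_norm x).mul_left K)
  have hs' : ∀ x : SeqLp p E, Summable fun n => T n (coord x n) := fun x => (hs x).of_norm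
  have hb : ∀ x : SeqLp p E, ‖∑' n, T n (coord x n)‖ ≤ K * ‖x‖ := fun x => by
    refine (norm_tsum_le_tsum_norm (hs x)).trans ?_
    rw [norm_eq, ← tsum_mul_left]
    exact (hs x).tsum_le_tsum (fun n => hT n _) ((summable_norm x).mul_left K)
  have hc : ∀ c : ℝ, Continuous fun a : F => c • a := fun c =>
    AddMonoidHomClass.continuous_of_bound (DistribSMul.toAddMonoidHom F c) (|c| ^ p)
      fun a => (PBanachSpace.norm_smul_eq (p := p) c a).le
  have : ContinuousConstSMul ℝ F := ⟨hc⟩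
  let L : SeqLp p E →ₗ[ℝ] F :=
    { toFun := fun x => ∑' n, T n (coord x n)
      map_add' := fun x y => by
        rw [← (hs' x).tsum_add (hs' y)]
        exact tsum_congr fun n => map_add (T n) _ _
      map_smul' := fun c x => by
        rw [RingHom.id_apply, ← (hs' x).tsum_const_smul]
        exact tsum_congr fun n => map_smul (T n) c _ }
  refine ⟨L.toCLMOfBound K hb, fun n a => ?_, fun x => rfl, hb⟩
  change ∑' m, T m (coord (single p E n a) m) = T n a
  rw [tsum_eq_single n]
  · exact congrArg (T n) (coordL_single_self (p := p) n a)
  · intro m hm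
    have : coord (single p E n a) m = 0 := coordL_single_of_ne (p := p) hm a
    rw [this, map_zero]

/-- `ℓ_p(ℓ_p(E)) ≃ ℓ_p(E)`. -/
theorem nonempty_equiv_seqLp : Nonempty (SeqLp p (SeqLp p E) ≃L[ℝ] SeqLp p E) := by
  have hA : ∀ n, ∃ L : SeqLp p E →L[ℝ] SeqLp p E,
      (∀ m a, L (single p E m a) = single p E (Nat.pair n m) a) ∧ ∀ x, ‖L x‖ ≤ 1 * ‖x‖ := fun n => by
    obtain ⟨L, h1, -, h3⟩ := exists_ofFamily (p := p) (fun m => single p E (Nat.pair n m)) (K := 1)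
      fun m a => by rw [norm_single, one_mul]
    exact ⟨L, h1, h3⟩
  choose L hL hL' using hA
  obtain ⟨A, hA, -, -⟩ := exists_ofFamily (p := p) L hL'
  obtain ⟨B, hB, -, -⟩ := exists_ofFamily (p := p)
    (fun k => (single p (SeqLp p E) k.unpair.1).comp (single p E k.unpair.2)) (K := 1)
    fun k a => by simp [norm_single]
  have hBA : B.comp A = ContinuousLinearMap.id ℝ _ := by
    refine clm_ext fun n x => ?_
    have : (B.comp A).comp (single p (SeqLp p E) n) = single p (SeqLp p E) n := by
      refine clm_ext fun m a => ?_
      simp [hA, hL, hB]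
    simpa using congrArg (fun T => T x) this
  have hAB : A.comp B = ContinuousLinearMap.id ℝ _ := by
    refine clm_ext fun n x => ?_
    simp [hA, hL, hB]
  exact ⟨ContinuousLinearEquiv.equivOfInverse A B (fun x => congrArg (fun T => T x) hBA)
    fun x => congrArg (fun T => T x) hAB⟩

end SeqLp

/-- `E` is isomorphic to a complemented subspace of `F`. -/
def IsComplementedIn (E F : Type*) [NormedAddCommGroup E] [Module ℝ E] [NormedAddCommGroup F]
    [Module ℝ F] : Prop :=
  ∃ (S : E →L[ℝ] F) (T : F →L[ℝ] E), ∀ x, T (S x) = x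

theorem IsComplementedIn.trans {E F G : Type*} [NormedAddCommGroup E] [Module ℝ E]
    [NormedAddCommGroup F] [Module ℝ F] [NormedAddCommGroup G] [Module ℝ G]
    (h : IsComplementedIn E F) (h' : IsComplementedIn F G) : IsComplementedIn E G := by
  obtain ⟨S, T, hTS⟩ := h
  obtain ⟨S', T', hTS'⟩ := h'
  exact ⟨S'.comp S, T.comp T', fun x => by simp [hTS, hTS']⟩

/-! ### Pełczyński decomposition -/

section Pelczynski

variable {p : ℝ} {E G : Type*} [NormedAddCommGroup E] [Module ℝ E]
  [NormedAddCommGroup G] [Module ℝ G] [PBanachSpace p G]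

-- Write G = P(G) ⊕ Q(G) with P(G) ≃ E. Shifting all the P-parts of a sequence one place up frees
-- the P-part of the zeroth term, which then receives E.
open SeqLp in
theorem IsComplementedIn.nonempty_prod_equiv (hp : 0 < p) (h : IsComplementedIn E G) :
    Nonempty ((E × SeqLp p G) ≃L[ℝ] SeqLp p G) := by
  obtain ⟨S, T, hTS⟩ := h
  let P : G →L[ℝ] G := S.comp T
  let Q : G →L[ℝ] G := ContinuousLinearMap.id ℝ G - P
  have hT : ∀ x, T (Q x) = 0 := fun x => by simp [P, Q, hTS]
  have hPP : ∀ x, P (P x) = P x := fun x => by simp [P, hTS]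
  have hPQ : ∀ x, P (Q x) = 0 := fun x => by simp [Q, hPP]
  have hQP : ∀ x, Q (P x) = 0 := fun x => by simp [Q, hPP]
  have hQQ : ∀ x, Q (Q x) = Q x := fun x => by simp [Q, hPP]
  have hPaddQ : ∀ x, Q x + P x = x := fun x => by simp [Q]
  have hQS : ∀ x, Q (S x) = 0 := fun x => by simp [Q, P, hTS]
  obtain ⟨KP, -, hKP⟩ := PBanachSpace.exists_bound hp P
  obtain ⟨KQ, -, hKQ⟩ := PBanachSpace.exists_bound hp Q
  obtain ⟨A, hA, -, -⟩ := exists_ofFamily (p := p)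
    (fun k => (single p G k).comp Q + (single p G (k + 1)).comp P) (K := KQ + KP)
    fun k a => by
      rw [add_mul]
      refine (norm_add_le _ _).trans (add_le_add ?_ ?_)
      · simpa [norm_single] using hKQ a
      · simpa [norm_single] using hKP a
  obtain ⟨B, hB, -, -⟩ := exists_ofFamily (p := p)
    -- The inverse shift; the P-part of term 0 is dropped here because `V` sends it to E through
    -- `T`.
    (fun k => (single p G k).comp Q + if k = 0 then 0 else (single p G (k - 1)).comp P)
    (K := KQ + KP) fun k a => by
      rw [add_mul]
      refine (norm_add_le _ _).trans (add_le_add ?_ ?_)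
      · simpa [norm_single] using hKQ a
      · split_ifs
        · simpa using (norm_nonneg _).trans (hKP a)
        · simpa [norm_single] using hKP a
  let U : (E × SeqLp p G) →L[ℝ] SeqLp p G := ((single p G 0).comp S).coprod A
  let V : SeqLp p G →L[ℝ] E × SeqLp p G := (T.comp (coordL p G 0)).prod B
  have h0 : ∀ (k : ℕ) (a : G), coordL p G 0 (single p G (k + 1) a) = 0 := fun k a =>
    coordL_single_of_ne (Nat.succ_ne_zero k).symm a
  have hUV : U.comp V = ContinuousLinearMap.id ℝ _ := by
    refine clm_ext fun n a => ?_
    rcases n with _ | n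
    · simp only [ContinuousLinearMap.comp_apply, U, V, ContinuousLinearMap.prod_apply,
        ContinuousLinearMap.coprod_apply, hB, coordL_single_self, add_apply,
        if_true, add_zero, hA, hQQ, hPQ, map_zero,
        ContinuousLinearMap.id_apply]
      rw [← map_add, add_comm]
      exact congrArg _ (hPaddQ a)
    · simp only [ContinuousLinearMap.comp_apply, U, V, ContinuousLinearMap.prod_apply,
        ContinuousLinearMap.coprod_apply, hB, add_apply,
        Nat.succ_ne_zero, if_false, map_add, hA, hQQ, hPQ, hQP, hPP, h0, map_zero, add_zero,
        zero_add, ContinuousLinearMap.id_apply, Nat.add_sub_cancel]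
      rw [← map_add, hPaddQ]
  have hVU : V.comp U = ContinuousLinearMap.id ℝ _ := by
    have hx : ∀ x, V (A x) = (0, x) := fun x => by
      have : V.comp A = ContinuousLinearMap.inr ℝ E (SeqLp p G) := by
        refine clm_ext fun n a => ?_
        rcases n with _ | n
        · simp [V, hA, hB, h0, hT, hQQ, hQP, hPP]
          rw [← map_add, hPaddQ]
        · simp [V, hA, hB, h0, hQQ, hQP, hPQ, hPP]
          rw [← map_add, hPaddQ]
      exact congrArg (fun T => T x) this
    have he : ∀ e, V (single p G 0 (S e)) = (e, 0) := fun e => by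
      simp [V, hB, hTS, hQS]
    refine ContinuousLinearMap.ext fun ⟨e, x⟩ => ?_
    simp [U, hx, he]
  exact ⟨ContinuousLinearEquiv.equivOfInverse U V (fun x => congrArg (fun T => T x) hVU)
    fun x => congrArg (fun T => T x) hUV⟩

theorem IsComplementedIn.nonempty_prod_equiv_self (hp : 0 < p)
    (h : IsComplementedIn E (SeqLp p G)) : Nonempty ((E × SeqLp p G) ≃L[ℝ] SeqLp p G) := by
  obtain ⟨e⟩ := h.nonempty_prod_equiv hp
  obtain ⟨f⟩ := SeqLp.nonempty_equiv_seqLp (p := p) (E := G)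
  exact ⟨((ContinuousLinearEquiv.refl ℝ E).prodCongr f.symm).trans (e.trans f)⟩

/-- Pełczyński's decomposition method for `ℓ_p`-sums. -/
theorem IsComplementedIn.nonempty_equiv (hp : 0 < p) (h : IsComplementedIn E (SeqLp p G))
    (h' : IsComplementedIn (SeqLp p G) E) : Nonempty (E ≃L[ℝ] SeqLp p G) := by
  obtain ⟨e⟩ := h.nonempty_prod_equiv_self hp
  obtain ⟨f⟩ := IsComplementedIn.nonempty_prod_equiv_self (E := SeqLp p G) hp
    ⟨ContinuousLinearMap.id ℝ _, ContinuousLinearMap.id ℝ _, fun _ => rfl⟩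
  obtain ⟨S, T, hTS⟩ := h'
  let V := T.ker
  let g : E ≃L[ℝ] SeqLp p G × V := ContinuousLinearEquiv.equivOfRightInverse T S hTS
  -- With Z the `ℓ_p`-sum: E ≃ Z × V ≃ (Z × Z) × V ≃ Z × (Z × V) ≃ Z × E ≃ E × Z ≃ Z.
  exact ⟨(g.trans ((f.symm.prodCongr (ContinuousLinearEquiv.refl ℝ V)).trans
    ((ContinuousLinearEquiv.prodAssoc ℝ _ _ _).trans
      (((ContinuousLinearEquiv.refl ℝ _).prodCongr g.symm).trans
        (ContinuousLinearEquiv.prodComm ℝ _ _))))).trans e⟩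

end Pelczynski

/-! ### The universal property of free `p`-spaces -/

namespace LipFree

/-- The triangle inequality bounds the image of every molecular representation by `K` times its
cost. Subtracting `f o` makes the free multiple of δ(o) irrelevant. -/
theorem norm_linearCombination_le {p : ℝ} {Y : Type*} [MetricSpace Y] {F : Type*}
    [NormedAddCommGroup F] [Module ℝ F] [PBanachSpace p F] (o : Y) {f : Y → F} {K : ℝ} (hK : 0 ≤ K)
    (hf : ∀ x y, ‖f x - f y‖ ≤ K * dist x y ^ p) (m : Y →₀ ℝ) :
    ‖Finsupp.linearCombination ℝ (fun x => f x - f o) m‖ ≤ K * freeGauge p o m := by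
  have hrep : ∀ l, IsMolecularRep o m l →
      ‖Finsupp.linearCombination ℝ (fun x => f x - f o) m‖ ≤ K * molecularCost p l := by
    rintro l ⟨c, rfl⟩
    rw [map_add, Finsupp.linearCombination_single, sub_self, smul_zero, add_zero]
    induction l with
    | nil => simp [molecularCost]
    | cons t l ih =>
      rw [List.map_cons, List.sum_cons, map_add, molecularCost, List.map_cons, List.sum_cons,
        mul_add]
      refine (norm_add_le _ _).trans (add_le_add ?_ ih)
      rw [map_smul, map_sub, Finsupp.linearCombination_single, Finsupp.linearCombination_single,
        one_smul, one_smul, sub_sub_sub_cancel_right, PBanachSpace.norm_smul_eq (p := p),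
        mul_left_comm]
      exact mul_le_mul_of_nonneg_left (hf _ _) (by positivity)
  rcases hK.eq_or_lt with rfl | hK
  · obtain ⟨l, hl⟩ := exists_isMolecularRep o m
    simpa using hrep l hl
  · rw [← div_le_iff₀' hK]
    refine le_freeGauge p fun l hl => ?_
    rw [div_le_iff₀' hK]
    exact hrep l hl

variable {p : ℝ} [Fact (0 < p)] {Y : Type*} [MetricSpace Y]

/-- The canonical map from the finitely supported functions to the free space. -/
def ofFinsupp (p : ℝ) [Fact (0 < p)] {Y : Type*} [MetricSpace Y] (o : Y) :
    PreLipFree p Y o →L[ℝ] LipFree p Y o :=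
  LinearMap.toCLMOfBound (F := LipFree p Y o)
    { toFun := fun m => (m : UniformSpace.Completion (PreLipFree p Y o))
      map_add' := fun a b => UniformSpace.Completion.coe_add a b
      map_smul' := fun c a => UniformSpace.Completion.coe_smul c a } 1
    fun m => by
      rw [one_mul]
      exact (UniformSpace.Completion.norm_coe m).le

theorem denseRange_ofFinsupp (o : Y) : DenseRange (ofFinsupp p o) :=
  UniformSpace.Completion.denseRange_coe

theorem norm_ofFinsupp (o : Y) (m : PreLipFree p Y o) : ‖ofFinsupp p o m‖ = ‖m‖ :=
  UniformSpace.Completion.norm_coe m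

theorem isUniformInducing_ofFinsupp (o : Y) : IsUniformInducing (ofFinsupp p o) :=
  UniformSpace.Completion.isUniformInducing_coe _

/-- The point evaluation `δ(x)`. -/
def delta (p : ℝ) [Fact (0 < p)] {Y : Type*} [MetricSpace Y] (o x : Y) : LipFree p Y o :=
  ofFinsupp p o (Finsupp.single x 1 : Y →₀ ℝ)

theorem norm_delta_sub_le (o x y : Y) : ‖delta p o x - delta p o y‖ ≤ dist x y ^ p := by
  have h : IsMolecularRep o (Finsupp.single x 1 - Finsupp.single y 1 : Y →₀ ℝ) [(1, x, y)] :=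
    ⟨0, by simp⟩
  have h' := freeGauge_le p h
  have h2 : ‖delta p o x - delta p o y‖ = freeGauge p o (Finsupp.single x 1 - Finsupp.single y 1) :=
    (congrArg norm (map_sub (ofFinsupp p o) _ _).symm).trans (norm_ofFinsupp o _)
  refine h2.trans_le (h'.trans_eq ?_)
  simp [molecularCost]

theorem delta_base (o : Y) : delta p o o = 0 := by
  have h : IsMolecularRep o (Finsupp.single o 1 : Y →₀ ℝ) [] := ⟨1, by simp⟩
  have h' := freeGauge_le p h
  rw [← norm_le_zero_iff]
  refine (norm_ofFinsupp o _).trans_le (h'.trans_eq ?_)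
  simp [molecularCost]

theorem norm_delta_le (o x : Y) : ‖delta p o x‖ ≤ dist x o ^ p := by
  simpa [delta_base] using norm_delta_sub_le (p := p) o x o

variable {F : Type*} [NormedAddCommGroup F] [Module ℝ F]

theorem clm_ext {o : Y} {S T : LipFree p Y o →L[ℝ] F}
    (h : ∀ x, S (delta p o x) = T (delta p o x)) : S = T := by
  have h1 : ∀ m : Y →₀ ℝ, S (ofFinsupp p o m) = T (ofFinsupp p o m) := by
    intro m
    induction m using Finsupp.induction_linear with
    | zero =>
      have e : ∀ L : LipFree p Y o →L[ℝ] F, L (ofFinsupp p o (0 : Y →₀ ℝ)) = 0 := fun L =>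
        (congrArg L (map_zero (ofFinsupp p o))).trans (map_zero L)
      exact (e S).trans (e T).symm
    | add f g hf hg =>
      have e : ∀ L : LipFree p Y o →L[ℝ] F,
          L (ofFinsupp p o (f + g)) = L (ofFinsupp p o f) + L (ofFinsupp p o g) := fun L =>
        (congrArg L (map_add (ofFinsupp p o) f g)).trans (map_add L _ _)
      exact (e S).trans ((congrArg₂ _ hf hg).trans (e T).symm)
    | single x a =>
      have e : ∀ L : LipFree p Y o →L[ℝ] F,
          L (ofFinsupp p o (Finsupp.single x a : Y →₀ ℝ)) = a • L (delta p o x) := fun L => by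
        have : (Finsupp.single x a : Y →₀ ℝ) = a • Finsupp.single x 1 := by simp
        exact (congrArg (fun m => L (ofFinsupp p o m)) this).trans
          ((congrArg L (map_smul (ofFinsupp p o) a _)).trans (map_smul L _ _))
      exact (e S).trans ((congrArg _ (h x)).trans (e T).symm)
  ext v
  exact congrFun ((denseRange_ofFinsupp o).equalizer S.continuous T.continuous (funext h1)) v

/-- The universal property of the free `p`-space. -/
theorem exists_lift [PBanachSpace p F] (o : Y) {f : Y → F} {K : ℝ} (hK : 0 ≤ K)
    (hf : ∀ x y, ‖f x - f y‖ ≤ K * dist x y ^ p) :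
    ∃ L : LipFree p Y o →L[ℝ] F,
      (∀ x, L (delta p o x) = f x - f o) ∧ ∀ v, ‖L v‖ ≤ K * ‖v‖ := by
  have : CompleteSpace F := PBanachSpace.complete p
  have hc : ∀ c : ℝ, Continuous fun a : F => c • a := fun c =>
    AddMonoidHomClass.continuous_of_bound (DistribSMul.toAddMonoidHom F c) (|c| ^ p)
      fun a => (PBanachSpace.norm_smul_eq (p := p) c a).le
  have : ContinuousConstSMul ℝ F := ⟨hc⟩
  have : ContinuousConstSMul ℝ (LipFree p Y o) :=
    inferInstanceAs (ContinuousConstSMul ℝ (UniformSpace.Completion (PreLipFree p Y o)))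
  let L₀ : PreLipFree p Y o →L[ℝ] F := LinearMap.toCLMOfBound
    (Finsupp.linearCombination ℝ (fun x => f x - f o) : (Y →₀ ℝ) →ₗ[ℝ] F) K
    fun m => norm_linearCombination_le o hK hf m
  let L : LipFree p Y o →L[ℝ] F := L₀.extend (ofFinsupp p o)
  have hL : ∀ m, L (ofFinsupp p o m) = L₀ m := fun m =>
    L₀.extend_eq (denseRange_ofFinsupp o) (isUniformInducing_ofFinsupp o) m
  refine ⟨L, fun x => ?_, fun v => ?_⟩
  · refine (hL _).trans ?_
    exact (Finsupp.linearCombination_single ℝ 1 x).trans (one_smul ℝ _)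
  · refine (denseRange_ofFinsupp o).induction_on (p := fun v => ‖L v‖ ≤ K * ‖v‖) v ?_ fun m => ?_
    · exact isClosed_le (continuous_norm.comp L.continuous) (continuous_const.mul continuous_norm)
    · rw [hL, norm_ofFinsupp]
      exact norm_linearCombination_le o hK hf m

end LipFree

/-- Two points together see at most `2 * m` nonzero coordinates, so coordinatewise Lipschitz bounds
add up to a bound in the `ℓ_p`-sum. -/
theorem SeqLp.exists_map_of_finite_support {p : ℝ} {E : Type*} [NormedAddCommGroup E]
    {Y : Type*} [MetricSpace Y] {G : ℕ → Y → E} {K : ℝ} {m : ℕ} (hK : 0 ≤ K)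
    (hG : ∀ n x y, ‖G n x - G n y‖ ≤ K * dist x y ^ p)
    (hs : ∀ x, ∃ s : Finset ℕ, s.card ≤ m ∧ ∀ n ∉ s, G n x = 0) :
    ∃ H : Y → SeqLp p E, (∀ x n, coord (H x) n = G n x) ∧
      ∀ x y, ‖H x - H y‖ ≤ (2 * m * K) * dist x y ^ p := by
  choose s hsc hs0 using hs
  refine ⟨fun x => ofSummable (fun n => G n x)
    (summable_of_ne_finset_zero (s := s x) fun n hn => by rw [hs0 x n hn, norm_zero]),
    fun x n => rfl, fun x y => ?_⟩
  classical
  rw [norm_eq, tsum_eq_sum (s := s x ∪ s y)]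
  · have hc : ((s x ∪ s y).card : ℝ) ≤ 2 * m := by
      exact_mod_cast (Finset.card_union_le _ _).trans (by linarith [hsc x, hsc y])
    calc ∑ n ∈ s x ∪ s y, ‖G n x - G n y‖ ≤ (s x ∪ s y).card • (K * dist x y ^ p) :=
          Finset.sum_le_card_nsmul _ _ _ fun n _ => hG n x y
      _ ≤ (2 * m) * (K * dist x y ^ p) := by
          rw [nsmul_eq_mul]
          exact mul_le_mul_of_nonneg_right hc (by positivity)
      _ = _ := by ring
  · intro n hn
    rw [Finset.notMem_union] at hn
    change ‖G n x - G n y‖ = 0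
    rw [hs0 x n hn.1, hs0 y n hn.2, sub_zero, norm_zero]

/-- Radial retractions onto a half-open annulus or onto the complement of the ball can hit the
sphere of radius 1, which lies only in the closure; the evaluations have to be extended there. -/
theorem exists_extend_closure {p : ℝ} (hp : 0 < p) {Y : Type*} [MetricSpace Y] {E : Type*}
    [NormedAddCommGroup E] [CompleteSpace E] {D : Set Y} {f : D → E} {K : ℝ}
    (hf : ∀ x y, ‖f x - f y‖ ≤ K * dist x y ^ p) :
    ∃ g : Y → E, (∀ x : D, g x = f x) ∧
      ∀ x ∈ closure D, ∀ y ∈ closure D, ‖g x - g y‖ ≤ K * dist x y ^ p := by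
  have hpow : Tendsto (fun t : ℝ => K * t ^ p) (𝓝 0) (𝓝 0) := by
    have := ((Real.continuous_rpow_const hp.le).tendsto 0).const_mul K
    simpa [Real.zero_rpow hp.ne'] using this
  have key : ∀ x ∈ closure D, ∃ (u : ℕ → D) (l : E),
      Tendsto (fun n => (u n : Y)) atTop (𝓝 x) ∧ Tendsto (fun n => f (u n)) atTop (𝓝 l) := by
    intro x hx
    obtain ⟨u, hu, hux⟩ := mem_closure_iff_seq_limit.1 hx
    refine ⟨fun n => ⟨u n, hu n⟩, ?_⟩
    have hc : CauchySeq fun n => f ⟨u n, hu n⟩ := by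
      rw [cauchySeq_iff_tendsto_dist_atTop_0]
      refine squeeze_zero (fun _ => dist_nonneg) (fun n => ?_)
        (hpow.comp (cauchySeq_iff_tendsto_dist_atTop_0.1 hux.cauchySeq))
      rw [dist_eq_norm]
      exact hf _ _
    obtain ⟨l, hl⟩ := cauchySeq_tendsto_of_complete hc
    exact ⟨l, hux, hl⟩
  choose! u l hu hl using key
  have hle : ∀ x ∈ closure D, ∀ y ∈ closure D, ‖l x - l y‖ ≤ K * dist x y ^ p := by
    intro x hx y hy
    refine le_of_tendsto_of_tendsto' ((hl x hx).sub (hl y hy)).norm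
      ((((hu x hx).dist (hu y hy)).rpow_const (Or.inr hp.le)).const_mul K) fun n => hf _ _
  refine ⟨l, fun x => ?_, hle⟩
  have hx := subset_closure x.2
  refine tendsto_nhds_unique (hl x hx) (tendsto_iff_dist_tendsto_zero.2 ?_)
  refine squeeze_zero (fun _ => dist_nonneg) (fun n => ?_)
    (hpow.comp (tendsto_iff_dist_tendsto_zero.1 (hu x hx)))
  rw [dist_eq_norm]
  exact hf _ _

/-! ### Weights depending on the logarithm of the distance to the base point -/

section Weights

variable {Y : Type*} [MetricSpace Y]

/-- A product rule: the difference is (w x - w y) f(y) + w x (f x - f y). The weight varies at rate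
L / d(o, y), which the growth bound C d(o, y) ^ p on `f` compensates. Bounds on `f` are needed only
where the weight is nonzero. -/
theorem norm_smul_sub_smul_le {p : ℝ} (hp : 0 < p) {E : Type*} [NormedAddCommGroup E] [Module ℝ E]
    [PBanachSpace p E] {o : Y} {w : Y → ℝ} {f : Y → E} {C L K : ℝ} (hC₀ : 0 ≤ C) (hL₀ : 0 ≤ L)
    (hK₀ : 0 ≤ K) (hw₁ : ∀ x, |w x| ≤ 1)
    (hw : ∀ x y, |w x - w y| * dist o y ≤ L * dist x y)
    (hC : ∀ x, w x ≠ 0 → ‖f x‖ ≤ C * dist o x ^ p)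
    (hK : ∀ x y, w x ≠ 0 → w y ≠ 0 → ‖f x - f y‖ ≤ K * dist x y ^ p) (x y : Y) :
    ‖w x • f x - w y • f y‖ ≤ (C * L ^ p + K) * dist x y ^ p := by
  have hdiff : ∀ x y, w y ≠ 0 → ‖(w x - w y) • f y‖ ≤ C * L ^ p * dist x y ^ p := by
    intro x y hy
    rw [PBanachSpace.norm_smul_eq (p := p)]
    calc |w x - w y| ^ p * ‖f y‖ ≤ |w x - w y| ^ p * (C * dist o y ^ p) :=
          mul_le_mul_of_nonneg_left (hC y hy) (by positivity)
      _ = C * (|w x - w y| * dist o y) ^ p := by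
          rw [Real.mul_rpow (abs_nonneg _) dist_nonneg]; ring
      _ ≤ C * (L * dist x y) ^ p :=
          mul_le_mul_of_nonneg_left
            (Real.rpow_le_rpow (by positivity) (hw x y) hp.le) hC₀
      _ = _ := by rw [Real.mul_rpow hL₀ dist_nonneg]; ring
  have hKd : 0 ≤ K * dist x y ^ p := by positivity
  rw [add_mul]
  by_cases hy : w y = 0
  · by_cases hx : w x = 0
    · rw [hx, hy, zero_smul, zero_smul, sub_zero, norm_zero]
      positivity
    · have h := hdiff y x hx
      rw [hy, zero_sub, neg_smul, norm_neg, dist_comm] at h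
      rw [hy, zero_smul, sub_zero]
      linarith
  · by_cases hx : w x = 0
    · have h := hdiff x y hy
      rw [hx, zero_sub, neg_smul] at h
      rw [hx, zero_smul, zero_sub]
      linarith
    · have e : w x • f x - w y • f y = (w x - w y) • f y + w x • (f x - f y) := by
        rw [sub_smul, smul_sub]; abel
      rw [e]
      refine (norm_add_le _ _).trans (add_le_add (hdiff x y hy) ?_)
      rw [PBanachSpace.norm_smul_eq (p := p)]
      refine (mul_le_of_le_one_left (norm_nonneg _)
        (Real.rpow_le_one (abs_nonneg _) (hw₁ x) hp.le)).trans (hK x y hx hy)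

/-- The weight `ω(log d(o, x))`, which vanishes at the base point. -/
def logWeight (ω : ℝ → ℝ) (o x : Y) : ℝ :=
  open Classical in if x = o then 0 else ω (Real.log (dist o x))

theorem logWeight_of_ne (ω : ℝ → ℝ) {o x : Y} (h : x ≠ o) :
    logWeight ω o x = ω (Real.log (dist o x)) := if_neg h

theorem logWeight_base (ω : ℝ → ℝ) (o : Y) : logWeight ω o o = 0 := if_pos rfl

theorem ne_of_logWeight_ne_zero {ω : ℝ → ℝ} {o x : Y} (h : logWeight ω o x ≠ 0) : x ≠ o := by
  rintro rfl
  exact h (logWeight_base ω x)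

theorem abs_logWeight_le {ω : ℝ → ℝ} (h : ∀ t, |ω t| ≤ 1) (o x : Y) : |logWeight ω o x| ≤ 1 := by
  unfold logWeight
  split_ifs
  · simp
  · exact h _

/-- For comparable radii the logarithm has slope of order 1 / d(o, y), which gives the `2 * k`.
Otherwise d(o, y) is itself controlled by the distance and the bound on `ω` suffices, which gives
the `4`. -/
theorem abs_logWeight_sub_mul_le {ω : ℝ → ℝ} {k : ℝ} (hk : 0 ≤ k) (h : ∀ t, |ω t| ≤ 1)
    (hω : ∀ s t, |ω s - ω t| ≤ k * |s - t|) (o x y : Y) :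
    |logWeight ω o x - logWeight ω o y| * dist o y ≤ (2 * k + 4) * dist x y := by
  have hd : 0 ≤ dist x y := dist_nonneg
  have hkd : 0 ≤ k * dist x y := by positivity
  rcases eq_or_ne y o with rfl | hy
  · rw [dist_self, mul_zero]
    positivity
  have hb : 0 < dist o y := dist_pos.2 hy.symm
  rcases eq_or_ne x o with rfl | hx
  · rw [logWeight_base, zero_sub, abs_neg]
    have := mul_le_of_le_one_left hb.le (abs_logWeight_le h x y)
    linarith
  have ha : 0 < dist o x := dist_pos.2 hx.symm
  have h1 : dist o y ≤ dist o x + dist x y := dist_triangle _ _ _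
  have h2 : dist o x ≤ dist o y + dist x y := by
    rw [dist_comm x y]; exact dist_triangle _ _ _
  rw [logWeight_of_ne ω hx, logWeight_of_ne ω hy]
  set a := dist o x
  set b := dist o y
  rcases le_or_gt b (2 * a) with hab | hab
  · have h3 : |Real.log a - Real.log b| * b ≤ 2 * dist x y := by
      rw [← abs_of_pos hb, ← abs_mul, abs_of_pos hb, abs_le]
      have e1 := Real.log_le_sub_one_of_pos (div_pos ha hb)
      have e2 := Real.log_le_sub_one_of_pos (div_pos hb ha)
      rw [Real.log_div ha.ne' hb.ne'] at e1
      rw [Real.log_div hb.ne' ha.ne'] at e2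
      have e1' := mul_le_mul_of_nonneg_right e1 hb.le
      rw [sub_mul _ 1, div_mul_cancel₀ _ hb.ne'] at e1'
      have e2' := mul_le_mul_of_nonneg_right e2 hb.le
      have e3 : (b / a - 1) * b ≤ 2 * dist x y := by
        have : (b / a - 1) * b = (b - a) * (b / a) := by field_simp
        rw [this]
        have hba : b / a ≤ 2 := by rwa [div_le_iff₀ ha]
        have hba0 : 0 ≤ b / a := by positivity
        nlinarith
      constructor <;> linarith
    calc |ω (Real.log a) - ω (Real.log b)| * b ≤ (k * |Real.log a - Real.log b|) * b :=
          mul_le_mul_of_nonneg_right (hω _ _) hb.le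
      _ = k * (|Real.log a - Real.log b| * b) := by ring
      _ ≤ k * (2 * dist x y) := mul_le_mul_of_nonneg_left h3 hk
      _ ≤ _ := by linarith
  -- Here `b > 2 * a`, so `b ≤ a + dist x y` forces `b ≤ 2 * dist x y`.
  · have h3 : |ω (Real.log a) - ω (Real.log b)| ≤ 2 :=
      (abs_sub _ _).trans (by linarith [h (Real.log a), h (Real.log b)])
    have := mul_le_mul_of_nonneg_right h3 hb.le
    linarith

end Weights

/-! ### Dilations -/

/-- A one-parameter group of dilations of a pointed metric space whose rays are almost
orthogonal to the spheres about the base point. -/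
structure IsDilation {Y : Type*} [MetricSpace Y] (o : Y) (dil : ℝ → Y → Y) : Prop where
  dil_one : ∀ x, dil 1 x = x
  dil_dil : ∀ {s t : ℝ}, 0 < s → 0 < t → ∀ x, dil s (dil t x) = dil (s * t) x
  dil_base : ∀ s, dil s o = o
  dist_dil : ∀ {s : ℝ}, 0 < s → ∀ x y, dist (dil s x) (dil s y) = s * dist x y
  dist_dil_self_le : ∀ {s : ℝ}, 0 < s → s ≤ 1 → ∀ x y, dist o y ≤ s * dist o x →
    dist x (dil s x) ≤ dist x y
  tendsto_dil : ∀ x, Tendsto (fun s => dil s x) (𝓝[>] 1) (𝓝 x)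

/-- The radial map that sends the sphere of radius `t` to the sphere of radius `g t`. -/
def radialMap {Y : Type*} [MetricSpace Y] (o : Y) (dil : ℝ → Y → Y) (g : ℝ → ℝ) (x : Y) : Y :=
  dil (g (dist o x) / dist o x) x

namespace IsDilation

variable {Y : Type*} [MetricSpace Y] {o : Y} {dil : ℝ → Y → Y} (h : IsDilation o dil)
include h

theorem dist_base_dil {s : ℝ} (hs : 0 < s) (x : Y) : dist o (dil s x) = s * dist o x := by
  conv_lhs => rw [← h.dil_base s]
  exact h.dist_dil hs o x

theorem dil_inv_dil {s : ℝ} (hs : 0 < s) (x : Y) : dil s⁻¹ (dil s x) = x := by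
  rw [h.dil_dil (inv_pos.2 hs) hs, inv_mul_cancel₀ hs.ne', h.dil_one]

theorem dil_dil_inv {s : ℝ} (hs : 0 < s) (x : Y) : dil s (dil s⁻¹ x) = x := by
  rw [h.dil_dil hs (inv_pos.2 hs), mul_inv_cancel₀ hs.ne', h.dil_one]

theorem radialMap_base (g : ℝ → ℝ) : radialMap o dil g o = o := h.dil_base _

theorem radialMap_eq_self {g : ℝ → ℝ} {x : Y} (hx : x ≠ o) (hg : g (dist o x) = dist o x) :
    radialMap o dil g x = x := by
  rw [radialMap, hg, div_self (dist_pos.2 hx.symm).ne', h.dil_one]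

theorem dist_base_radialMap {g : ℝ → ℝ} {x : Y} (hx : x ≠ o) (hg : 0 < g (dist o x)) :
    dist o (radialMap o dil g x) = g (dist o x) := by
  have hx' := dist_pos.2 hx.symm
  rw [radialMap, h.dist_base_dil (div_pos hg hx'), div_mul_cancel₀ _ hx'.ne']

/-- The profile `g` increases while g(t)/t decreases. For a ≤ b, compare through the point on the
ray of y at radius g(a): moving from x to the ray of y at radius a costs at most 2 d(x, y), changing
radius along the ray costs at most d(x, y), and both are scaled by at most K. -/
theorem dist_radialMap_le {g : ℝ → ℝ} (hg : ∀ t, 0 < t → 0 < g t)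
    (hmono : ∀ s t, 0 < s → s ≤ t → g s ≤ g t ∧ g t * s ≤ g s * t) {K : ℝ} {x y : Y}
    (hx : x ≠ o) (hy : y ≠ o) (hxK : g (dist o x) ≤ K * dist o x)
    (hyK : g (dist o y) ≤ K * dist o y) :
    dist (radialMap o dil g x) (radialMap o dil g y) ≤ 3 * K * dist x y := by
  wlog hxy : dist o x ≤ dist o y generalizing x y
  · rw [dist_comm, dist_comm x y]
    exact this hy hx hyK hxK (le_of_not_ge hxy)
  have ha := dist_pos.2 hx.symm
  have hb := dist_pos.2 hy.symm
  unfold radialMap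
  set a := dist o x with hadef
  set b := dist o y with hbdef
  have hga := hg a ha
  have hgb := hg b hb
  obtain ⟨hm1, hm2⟩ := hmono a b ha hxy
  have hKa : g a / a ≤ K := by rwa [div_le_iff₀ ha]
  have hKb : g b / b ≤ K := by rwa [div_le_iff₀ hb]
  have e1 : dil (g a / a) (dil (a / b) y) = dil (g a / b) y := by
    rw [h.dil_dil (by positivity) (by positivity)]
    congr 1; field_simp
  have e2 : dil (g b / b) (dil (g a / g b) y) = dil (g a / b) y := by
    rw [h.dil_dil (by positivity) (by positivity)]
    congr 1; field_simp
  have h1 : dist y (dil (a / b) y) ≤ dist y x :=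
    h.dist_dil_self_le (by positivity) (by rwa [div_le_one hb]) y x
      (by rw [← hadef, ← hbdef, div_mul_cancel₀ _ hb.ne'])
  -- Monotonicity of g(t)/t says that `x` has radius at most that of the rescaled point, so
  -- `dist_dil_self_le` applies.
  have h2 : dist y (dil (g a / g b) y) ≤ dist y x :=
    h.dist_dil_self_le (by positivity) (by rwa [div_le_one hgb]) y x
      (by rw [← hadef, ← hbdef, div_mul_eq_mul_div, le_div_iff₀ hgb]; linarith)
  have h3 : dist (dil (g a / a) x) (dil (g a / b) y) ≤ K * (2 * dist x y) := by
    rw [← e1, h.dist_dil (by positivity)]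
    refine mul_le_mul hKa ?_ dist_nonneg (by linarith [div_pos hga ha])
    have := dist_triangle x y (dil (a / b) y)
    rw [dist_comm y x] at h1
    linarith
  have h4 : dist (dil (g a / b) y) (dil (g b / b) y) ≤ K * dist x y := by
    rw [← e2, h.dist_dil (by positivity), dist_comm, dist_comm x y]
    exact mul_le_mul hKb h2 dist_nonneg (by linarith [div_pos hga ha])
  refine (dist_triangle _ _ _).trans ((add_le_add h3 h4).trans_eq ?_)
  ring

end IsDilation

theorem abs_max_zero_sub_le (a b : ℝ) : |max 0 a - max 0 b| ≤ |a - b| := by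
  rw [max_comm 0 a, max_comm 0 b]
  exact abs_max_sub_max_le_abs a b 0

theorem abs_max_zero_min_one_sub_le (a b : ℝ) :
    |max 0 (min 1 a) - max 0 (min 1 b)| ≤ |a - b| := by
  refine (abs_max_zero_sub_le _ _).trans ((abs_min_sub_min_le_max 1 a 1 b).trans_eq ?_)
  rw [sub_self, abs_zero, max_eq_right (abs_nonneg (a - b))]

/-- Cross-multiplied form of the monotonicity of max(t, 1)/t, as required of a radial profile. -/
theorem max_one_mul_le {s t : ℝ} (hs : 0 < s) (hst : s ≤ t) :
    max t 1 * s ≤ max s 1 * t := by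
  rw [max_mul_of_nonneg _ _ hs.le, max_mul_of_nonneg _ _ (hs.le.trans hst), mul_comm s t]
  exact max_le_max_left _ (by linarith)

theorem min_mul_le {a b r s t : ℝ} (hs : 0 < s) (hst : s ≤ t) (hr : 0 ≤ r) (h : b * s ≤ a * t) :
    min b r * s ≤ min a r * t := by
  rw [min_mul_of_nonneg _ _ (hs.le.trans hst)]
  exact le_min ((mul_le_mul_of_nonneg_right (min_le_left _ _) hs.le).trans h)
    (mul_le_mul (min_le_right _ _) hst hs.le hr)

/-! ### Projections onto balls, complements of balls and annuli -/

section Complemented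

variable {p : ℝ} [Fact (0 < p)]

namespace LipFree

/-- A Lipschitz map into a free space that extends the evaluations of a subset `N` yields a
projection onto the free space over `N`. -/
theorem isComplementedIn_of_extension {Y : Type*} [MetricSpace Y] (o : Y) {N : Set Y} {n : N}
    {Φ : Y → LipFree p N n} {K : ℝ} (hK : 0 ≤ K)
    (hΦ : ∀ x y, ‖Φ x - Φ y‖ ≤ K * dist x y ^ p) (hN : ∀ x : N, Φ x = delta p n x) :
    IsComplementedIn (LipFree p N n) (LipFree p Y o) := by
  obtain ⟨S, hS, -⟩ := exists_lift (p := p) n (f := fun x : N => delta p o (x : Y)) zero_le_one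
    fun x y => by
      rw [one_mul]
      exact norm_delta_sub_le o (x : Y) y
  obtain ⟨T, hT, -⟩ := exists_lift (p := p) o hK hΦ
  have : T.comp S = ContinuousLinearMap.id ℝ _ := clm_ext fun x => by
    rw [ContinuousLinearMap.comp_apply, hS, map_sub, hT, hT, sub_sub_sub_cancel_right, hN, hN,
      delta_base, sub_zero, ContinuousLinearMap.id_apply]
  exact ⟨S, T, fun x => congrArg (fun L => L x) this⟩

end LipFree

namespace IsDilation

open LipFree

variable {Y : Type*} [MetricSpace Y] {o : Y} {dil : ℝ → Y → Y} (h : IsDilation o dil)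
include h

/-- The radial map with profile min(t, 1) is a 3-Lipschitz retraction onto the ball. -/
theorem isComplementedIn_unitBall :
    IsComplementedIn (LipFree p (unitBall o) ⟨o, mem_unitBall_self o⟩) (LipFree p Y o) := by
  have hp : 0 < p := Fact.out
  let g : ℝ → ℝ := fun t => min t 1
  have hg : ∀ t, 0 < t → 0 < g t := fun t ht => lt_min ht one_pos
  have hmono : ∀ s t, 0 < s → s ≤ t → g s ≤ g t ∧ g t * s ≤ g s * t := fun s t hs hst => by
    exact ⟨min_le_min_right 1 hst, min_mul_le hs hst zero_le_one (mul_comm t s).le⟩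
  have hr : ∀ x, dist o (radialMap o dil g x) = g (dist o x) := fun x => by
    rcases eq_or_ne x o with rfl | hx
    · rw [h.radialMap_base, dist_self]
      simp [g]
    · exact h.dist_base_radialMap hx (hg _ (dist_pos.2 hx.symm))
  have hmem : ∀ x, radialMap o dil g x ∈ unitBall o := fun x => (hr x).trans_le (min_le_right _ _)
  have hlip : ∀ x y, dist (radialMap o dil g x) (radialMap o dil g y) ≤ 3 * dist x y := by
    have hbase : ∀ y, dist o (radialMap o dil g y) ≤ 3 * dist o y := fun y => by
      rw [hr y]
      linarith [min_le_left (dist o y) 1, dist_nonneg (x := o) (y := y)]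
    intro x y
    rcases eq_or_ne x o with rfl | hx
    · rw [h.radialMap_base]
      exact hbase y
    rcases eq_or_ne y o with rfl | hy
    · rw [h.radialMap_base, dist_comm, dist_comm x y]
      exact hbase x
    have := h.dist_radialMap_le hg hmono (K := 1) hx hy (by rw [one_mul]; exact min_le_left _ _)
      (by rw [one_mul]; exact min_le_left _ _)
    rwa [mul_one] at this
  refine isComplementedIn_of_extension (p := p) o (K := 3 ^ p)
    (Φ := fun x => delta p _ ⟨radialMap o dil g x, hmem x⟩) (by positivity) (fun x y => ?_)
    fun x => ?_
  · refine (norm_delta_sub_le _ _ _).trans ?_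
    rw [← Real.mul_rpow (by norm_num) dist_nonneg]
    exact Real.rpow_le_rpow dist_nonneg (hlip x y) hp.le
  · congr 1
    refine Subtype.ext ?_
    rcases eq_or_ne (x : Y) o with hx | hx
    · change radialMap o dil g x = x
      rw [hx, h.radialMap_base]
    · exact h.radialMap_eq_self hx (min_eq_left x.2)

/-- The evaluations on a set `D` outside of the open unit ball, cut off near the base point,
extend to a Lipschitz map on the whole space. -/
theorem exists_cutoff_extension {D : Set Y} (c : D) {g : ℝ → ℝ}
    (hmono : ∀ s t, 0 < s → s ≤ t → g s ≤ g t ∧ g t * s ≤ g s * t)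
    (hg₁ : ∀ t, 0 < t → 1 ≤ g t) (hg₂ : ∀ t, 1 / 2 < t → g t ≤ 2 * t)
    (hgcl : ∀ x, x ≠ o → radialMap o dil g x ∈ closure D)
    (hgD : ∀ x ∈ D, g (dist o x) = dist o x) (hD : o ∉ D) {ω : ℝ → ℝ} {k : ℝ} (hk : 0 ≤ k)
    (hω₁ : ∀ t, |ω t| ≤ 1) (hω : ∀ s t, |ω s - ω t| ≤ k * |s - t|)
    (hω₀ : ∀ t, ω t ≠ 0 → -Real.log 2 < t) (hωD : ∀ x ∈ D, ω (Real.log (dist o x)) = 1) :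
    ∃ (Φ : Y → LipFree p D c) (K : ℝ), 0 ≤ K ∧ (∀ x y, ‖Φ x - Φ y‖ ≤ K * dist x y ^ p) ∧
      (∀ x : D, Φ x = delta p c x) ∧ ∀ x, Φ x ≠ 0 → logWeight ω o x ≠ 0 := by
  have hp : 0 < p := Fact.out
  have : CompleteSpace (LipFree p D c) := PBanachSpace.complete p
  obtain ⟨δ, hδD, hδ⟩ := exists_extend_closure hp (f := fun x : D => delta p c x) (K := 1)
    fun x y => by
      rw [one_mul]
      exact norm_delta_sub_le c x y
  have hsupp : ∀ x, logWeight ω o x ≠ 0 → x ≠ o ∧ 1 / 2 < dist o x := fun x hx => by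
    have hxo := ne_of_logWeight_ne_zero hx
    refine ⟨hxo, ?_⟩
    rw [logWeight_of_ne ω hxo] at hx
    have h1 := hω₀ _ hx
    rw [← Real.log_inv, Real.log_lt_log_iff (by norm_num) (dist_pos.2 hxo.symm)] at h1
    rwa [one_div]
  have hg : ∀ t, 0 < t → 0 < g t := fun t ht => one_pos.trans_le (hg₁ t ht)
  -- On the support 1 ≤ g(t) ≤ 2t, hence g(t) + d(o, c) ≤ 2(1 + d(o, c)) t.
  have hC : ∀ x, logWeight ω o x ≠ 0 →
      ‖δ (radialMap o dil g x)‖ ≤ (2 * (1 + dist o c)) ^ p * dist o x ^ p := by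
    intro x hx
    obtain ⟨hxo, hx2⟩ := hsupp x hx
    have h1 := hδ _ (hgcl x hxo) _ (subset_closure c.2)
    rw [hδD c, delta_base, sub_zero, one_mul] at h1
    refine h1.trans ?_
    have hc : 0 ≤ dist o (c : Y) := dist_nonneg
    rw [← Real.mul_rpow (by positivity) dist_nonneg]
    refine Real.rpow_le_rpow dist_nonneg ?_ hp.le
    have h2 := dist_triangle_left (radialMap o dil g x) (c : Y) o
    have hx0 := dist_pos.2 hxo.symm
    rw [h.dist_base_radialMap hxo (hg _ hx0)] at h2
    have h3 := hg₂ _ hx2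
    have h4 := hg₁ _ hx0
    nlinarith
  have hK : ∀ x y, logWeight ω o x ≠ 0 → logWeight ω o y ≠ 0 →
      ‖δ (radialMap o dil g x) - δ (radialMap o dil g y)‖ ≤ (3 * 2) ^ p * dist x y ^ p := by
    intro x y hx hy
    obtain ⟨hxo, hx2⟩ := hsupp x hx
    obtain ⟨hyo, hy2⟩ := hsupp y hy
    refine (hδ _ (hgcl x hxo) _ (hgcl y hyo)).trans ?_
    rw [one_mul, ← Real.mul_rpow (by norm_num) dist_nonneg]
    exact Real.rpow_le_rpow dist_nonneg
      (h.dist_radialMap_le hg hmono hxo hyo (hg₂ _ hx2) (hg₂ _ hy2)) hp.le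
  refine ⟨fun x => logWeight ω o x • δ (radialMap o dil g x),
    (2 * (1 + dist o (c : Y))) ^ p * (2 * k + 4) ^ p + (3 * 2) ^ p, by positivity,
    norm_smul_sub_smul_le hp (by positivity) (by positivity) (by positivity)
      (abs_logWeight_le hω₁ o) (abs_logWeight_sub_mul_le hk hω₁ hω o) hC hK,
    fun x => ?_, fun x hx hx' => hx ?_⟩
  · have hxo : (x : Y) ≠ o := fun e => hD (e ▸ x.2)
    dsimp only
    rw [logWeight_of_ne ω hxo, hωD x x.2, one_smul, h.radialMap_eq_self hxo (hgD x x.2), hδD]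
  · dsimp only
    rw [hx', zero_smul]

/-- Points of the unit sphere are limits of their dilates by s ↓ 1. -/
theorem mem_closure_annulus {R : ℝ} (hR : 1 < R) {x : Y} (hx : dist o x ∈ Set.Icc 1 R) :
    x ∈ closure (annulus o (Set.Ioc 1 R)) := by
  rcases hx.1.lt_or_eq with h1 | h1
  · exact subset_closure ⟨h1, hx.2⟩
  · refine mem_closure_of_tendsto (h.tendsto_dil x) ?_
    filter_upwards [Ioc_mem_nhdsGT hR] with s hs
    change dist o (dil s x) ∈ Set.Ioc 1 R
    rwa [h.dist_base_dil (one_pos.trans hs.1), ← h1, mul_one]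

theorem mem_closure_compl_unitBall {x : Y} (hx : 1 ≤ dist o x) :
    x ∈ closure (unitBall o)ᶜ := by
  refine closure_mono ?_ (h.mem_closure_annulus (R := dist o x + 1) (by linarith)
    ⟨hx, by linarith⟩)
  intro y hy hy'
  exact absurd hy.1 (not_lt.2 hy')

/-- The profile max(t, 1) is not Lipschitz-bounded near the base point, so a cutoff `ω` rises from 0
at radius 1/2 to 1 at radius 1. -/
theorem isComplementedIn_compl_unitBall (b : ((unitBall o)ᶜ : Set Y)) :
    IsComplementedIn (LipFree p ((unitBall o)ᶜ : Set Y) b) (LipFree p Y o) := by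
  have hlog : 0 < Real.log 2 := Real.log_pos one_lt_two
  have hD : ∀ x ∈ (unitBall o)ᶜ, 1 < dist o x := fun x hx => not_le.1 hx
  obtain ⟨Φ, K, hK, hΦ, hΦD, -⟩ := h.exists_cutoff_extension (p := p) b
    (g := fun t => max t 1) (ω := fun t => max 0 (min 1 (1 + t / Real.log 2)))
    (k := 1 / Real.log 2)
    (fun s t hs hst => ⟨max_le_max_right 1 hst, max_one_mul_le hs hst⟩)
    (fun t _ => le_max_right _ _)
    (fun t ht => max_le (by linarith) (by linarith))
    (fun x hx => h.mem_closure_compl_unitBall (by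
      rw [h.dist_base_radialMap (g := fun t => max t 1) hx (lt_max_of_lt_right one_pos)]
      exact le_max_right _ _))
    (fun x hx => max_eq_left (hD x hx).le)
    (fun ho => absurd (hD o ho) (by simp))
    (by positivity)
    (fun t => abs_le.2 ⟨by linarith [le_max_left 0 (min 1 (1 + t / Real.log 2))],
      max_le zero_le_one (min_le_left _ _)⟩)
    (fun s t => by
      refine (abs_max_zero_min_one_sub_le _ _).trans ?_
      rw [add_sub_add_left_eq_sub, ← sub_div, abs_div, abs_of_pos hlog]
      exact (one_div_mul_eq_div _ _).ge)
    (fun t ht => by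
      by_contra! hle
      refine ht (max_eq_left ((min_le_right _ _).trans ?_))
      have : t / Real.log 2 ≤ -1 := by rw [div_le_iff₀ hlog]; linarith
      linarith)
    (fun x hx => by
      have : 0 ≤ Real.log (dist o x) / Real.log 2 :=
        div_nonneg (Real.log_nonneg (hD x hx).le) hlog.le
      rw [min_eq_left (by linarith), max_eq_right zero_le_one])
  exact isComplementedIn_of_extension o hK hΦ hΦD

/-- The cutoff is a trapezoid in the logarithm of the radius, equal to 1 on the annulus. Its
explicit support lets dilated copies be made disjoint. -/
theorem exists_annulus_extension {R : ℝ} (hR : 1 < R) (c : annulus o (Set.Ioc 1 R)) :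
    ∃ (Φ : Y → LipFree p (annulus o (Set.Ioc 1 R)) c) (K : ℝ), 0 ≤ K ∧
      (∀ x y, ‖Φ x - Φ y‖ ≤ K * dist x y ^ p) ∧
      (∀ x : annulus o (Set.Ioc 1 R), Φ x = delta p c x) ∧
      ∀ x, Φ x ≠ 0 → 1 / 2 < dist o x ∧ dist o x < 2 * R := by
  have hlog : 0 < Real.log 2 := Real.log_pos one_lt_two
  obtain ⟨Φ, K, hK, hΦ, hΦD, hΦ0⟩ := h.exists_cutoff_extension (p := p) c
    (g := fun t => min (max t 1) R)
    (ω := fun t => max 0 (min 1 (1 + min t (Real.log R - t) / Real.log 2)))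
    (k := 1 / Real.log 2)
    (fun s t hs hst => ⟨min_le_min_right R (max_le_max_right 1 hst),
      min_mul_le hs hst (by linarith) (max_one_mul_le hs hst)⟩)
    (fun t _ => le_min (le_max_right _ _) hR.le)
    (fun t ht => (min_le_left _ _).trans (max_le (by linarith) (by linarith)))
    (fun x hx => h.mem_closure_annulus hR (by
      rw [h.dist_base_radialMap (g := fun t => min (max t 1) R) hx
        (lt_min (lt_max_of_lt_right one_pos) (one_pos.trans hR))]
      exact ⟨le_min (le_max_right _ _) hR.le, min_le_right _ _⟩))
    (fun x hx => by rw [max_eq_left hx.1.le, min_eq_left hx.2])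
    (fun ho => absurd ho.1 (by simp))
    (by positivity)
    (fun t => abs_le.2
      ⟨by linarith [le_max_left 0 (min 1 (1 + min t (Real.log R - t) / Real.log 2))],
        max_le zero_le_one (min_le_left _ _)⟩)
    (fun s t => by
      refine (abs_max_zero_min_one_sub_le _ _).trans ?_
      rw [add_sub_add_left_eq_sub, ← sub_div, abs_div, abs_of_pos hlog, one_div_mul_eq_div]
      refine div_le_div_of_nonneg_right ((abs_min_sub_min_le_max _ _ _ _).trans ?_) hlog.le
      rw [sub_sub_sub_cancel_left, abs_sub_comm t s, max_self])
    (fun t ht => by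
      by_contra! hle
      refine ht (max_eq_left ((min_le_right _ _).trans ?_))
      have : min t (Real.log R - t) / Real.log 2 ≤ -1 := by
        rw [div_le_iff₀ hlog]
        linarith [min_le_left t (Real.log R - t)]
      linarith)
    (fun x hx => by
      have hx0 : 0 < dist o x := one_pos.trans hx.1
      have : 0 ≤ min (Real.log (dist o x)) (Real.log R - Real.log (dist o x)) / Real.log 2 :=
        div_nonneg (le_min (Real.log_nonneg hx.1.le)
          (sub_nonneg.2 (Real.log_le_log hx0 hx.2))) hlog.le
      rw [min_eq_left (by linarith), max_eq_right zero_le_one])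
  refine ⟨Φ, K, hK, hΦ, hΦD, fun x hx => ?_⟩
  have hw := hΦ0 x hx
  have hxo := ne_of_logWeight_ne_zero hw
  have hx0 : 0 < dist o x := dist_pos.2 hxo.symm
  rw [logWeight_of_ne _ hxo] at hw
  have hlt : -1 < min (Real.log (dist o x)) (Real.log R - Real.log (dist o x)) / Real.log 2 := by
    by_contra! hle
    exact hw (max_eq_left ((min_le_right _ _).trans (by linarith)))
  rw [lt_div_iff₀ hlog, lt_min_iff] at hlt
  constructor
  · rw [one_div, ← Real.log_lt_log_iff (by norm_num) hx0, Real.log_inv]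
    linarith
  · rw [← Real.log_lt_log_iff hx0 (by positivity), Real.log_mul (by norm_num) (by positivity)]
    linarith

end IsDilation

end Complemented

/-! ### Sparse dilates of an annulus -/

namespace IsDilation

open LipFree

variable {p : ℝ} [Fact (0 < p)] {Y : Type*} [MetricSpace Y] {o : Y} {dil : ℝ → Y → Y}
  (h : IsDilation o dil)
include h

theorem norm_smul_delta_dil_sub_le {s : ℝ} (hs : 0 < s) (a x y : Y) :
    ‖s⁻¹ • delta p a (dil s x) - s⁻¹ • delta p a (dil s y)‖ ≤ dist x y ^ p := by
  rw [← smul_sub, PBanachSpace.norm_smul_eq (p := p), abs_of_pos (inv_pos.2 hs)]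
  refine (mul_le_mul_of_nonneg_left (norm_delta_sub_le _ _ _) (by positivity)).trans_eq ?_
  rw [h.dist_dil hs, ← Real.mul_rpow (by positivity) (by positivity),
    inv_mul_cancel_left₀ hs.ne']

omit [Fact (0 < p)] in
theorem norm_smul_comp_dil_sub_le {E : Type*} [NormedAddCommGroup E] [Module ℝ E]
    [PBanachSpace p E] {Φ : Y → E} {K : ℝ} (hΦ : ∀ x y, ‖Φ x - Φ y‖ ≤ K * dist x y ^ p)
    {s : ℝ} (hs : 0 < s) (x y : Y) :
    ‖s • Φ (dil s⁻¹ x) - s • Φ (dil s⁻¹ y)‖ ≤ K * dist x y ^ p := by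
  rw [← smul_sub, PBanachSpace.norm_smul_eq (p := p), abs_of_pos hs]
  refine (mul_le_mul_of_nonneg_left (hΦ _ _) (by positivity)).trans_eq ?_
  rw [h.dist_dil (inv_pos.2 hs), Real.mul_rpow (by positivity) (by positivity),
    Real.inv_rpow hs.le]
  have : 0 < s ^ p := by positivity
  field_simp

/-- If a set contains a sparse sequence of dilated copies of an annulus, then the free space over
it contains a complemented copy of the `ℓ_p`-sum of the free space over the annulus. -/
theorem isComplementedIn_of_sparse {R : ℝ} (hR : 1 < R) (c : annulus o (Set.Ioc 1 R))
    {s : ℕ → ℝ} (hs : ∀ k, 0 < s k)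
    (hsep : ∀ j k, j ≠ k → 4 * R * s j ≤ s k ∨ 4 * R * s k ≤ s j) {N : Set Y} (n : N)
    (hN : ∀ k, ∀ a ∈ annulus o (Set.Ioc 1 R), dil (s k) a ∈ N) :
    IsComplementedIn (SeqLp p (LipFree p (annulus o (Set.Ioc 1 R)) c)) (LipFree p N n) := by
  obtain ⟨Φ, K, hK, hΦ, hΦA, hΦ0⟩ := h.exists_annulus_extension (p := p) hR c
  -- The ratio `4 * R` is exactly what separates the windows (s/2, 2Rs) containing the supports.
  have hunique : ∀ (x : Y) (j k : ℕ), 1 / 2 * s j < dist o x → dist o x < 2 * R * s j →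
      1 / 2 * s k < dist o x → dist o x < 2 * R * s k → j = k := by
    intro x j k h1 h2 h3 h4
    by_contra hjk
    rcases hsep j k hjk with h5 | h5 <;> linarith
  have hsupp : ∀ (x : Y) (k : ℕ), s k • Φ (dil (s k)⁻¹ x) ≠ 0 →
      1 / 2 * s k < dist o x ∧ dist o x < 2 * R * s k := by
    intro x k hk
    have h0 : Φ (dil (s k)⁻¹ x) ≠ 0 := fun e => hk (by rw [e, smul_zero])
    obtain ⟨h1, h2⟩ := hΦ0 _ h0
    have hsk := hs k
    rw [h.dist_base_dil (inv_pos.2 hsk), inv_mul_eq_div] at h1 h2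
    exact ⟨(lt_div_iff₀ hsk).1 h1, (div_lt_iff₀ hsk).1 h2⟩
  obtain ⟨H, hH, hHlip⟩ := SeqLp.exists_map_of_finite_support (p := p) (Y := N)
    (G := fun k x => s k • Φ (dil (s k)⁻¹ (x : Y))) (m := 1) hK
    (fun k x y => h.norm_smul_comp_dil_sub_le hΦ (hs k) (x : Y) y) fun x => by
      by_cases hx : ∃ k, s k • Φ (dil (s k)⁻¹ (x : Y)) ≠ 0
      · obtain ⟨k, hk⟩ := hx
        obtain ⟨h1, h2⟩ := hsupp x k hk
        refine ⟨{k}, by simp, fun j hj => ?_⟩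
        by_contra hj0
        obtain ⟨h3, h4⟩ := hsupp x j hj0
        exact hj (Finset.mem_singleton.2 (hunique x j k h3 h4 h1 h2))
      · push Not at hx
        exact ⟨∅, by simp, fun k _ => hx k⟩
  obtain ⟨T, hT, -⟩ := exists_lift (p := p) n (by positivity) hHlip
  have hS : ∀ k, ∃ L : LipFree p (annulus o (Set.Ioc 1 R)) c →L[ℝ] LipFree p N n,
      (∀ a : annulus o (Set.Ioc 1 R), L (delta p c a) =
        (s k)⁻¹ • delta p n ⟨dil (s k) a, hN k a a.2⟩ -
          (s k)⁻¹ • delta p n ⟨dil (s k) c, hN k c c.2⟩) ∧ ∀ v, ‖L v‖ ≤ 1 * ‖v‖ := fun k =>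
    exists_lift (p := p) c
      (f := fun a : annulus o (Set.Ioc 1 R) => (s k)⁻¹ • delta p n ⟨dil (s k) a, hN k a a.2⟩)
      zero_le_one fun x y => by
        rw [← smul_sub, PBanachSpace.norm_smul_eq (p := p), abs_of_pos (inv_pos.2 (hs k)), one_mul]
        refine (mul_le_mul_of_nonneg_left (norm_delta_sub_le _ _ _)
          (Real.rpow_nonneg (inv_pos.2 (hs k)).le p)).trans_eq ?_
        rw [Subtype.dist_eq, h.dist_dil (hs k),
          ← Real.mul_rpow (inv_pos.2 (hs k)).le (mul_nonneg (hs k).le dist_nonneg),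
          inv_mul_cancel_left₀ (hs k).ne']
        rfl
  choose L hL hL1 using hS
  obtain ⟨S, hS, -, -⟩ := SeqLp.exists_ofFamily (p := p) L hL1
  have hTS : T.comp S = ContinuousLinearMap.id ℝ _ := by
    refine SeqLp.clm_ext fun k v => ?_
    have : (T.comp S).comp (SeqLp.single p _ k) = SeqLp.single p _ k := by
      refine LipFree.clm_ext fun a => SeqLp.ext fun j => ?_
      have e : ((T.comp S).comp (SeqLp.single p _ k)) (delta p c a) =
          (s k)⁻¹ • (H ⟨dil (s k) a, hN k a a.2⟩ - H ⟨dil (s k) c, hN k c c.2⟩) := by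
        rw [ContinuousLinearMap.comp_apply, ContinuousLinearMap.comp_apply, hS, hL, map_sub,
          map_smul, map_smul, hT, hT, ← smul_sub, sub_sub_sub_cancel_right]
      rw [e]
      change (s k)⁻¹ • (SeqLp.coord (H _) j - SeqLp.coord (H _) j) =
        SeqLp.coordL p _ j (SeqLp.single p _ k (delta p c a))
      rw [hH, hH]
      rcases eq_or_ne j k with rfl | hjk
      · dsimp only
        rw [SeqLp.coordL_single_self, h.dil_inv_dil (hs j), h.dil_inv_dil (hs j), ← smul_sub,
          inv_smul_smul₀ (hs j).ne', hΦA, hΦA, delta_base, sub_zero]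
      -- The `k`-th dilate of the annulus lies in the `k`-th window, so all other coordinates vanish
      -- on it.
      · have hz : ∀ a : annulus o (Set.Ioc 1 R),
            s j • Φ (dil (s j)⁻¹ (dil (s k) (a : Y))) = 0 := by
          intro a
          by_contra h0
          obtain ⟨h1, h2⟩ := hsupp _ _ h0
          have hsk := hs k
          have ha : 1 < dist o (a : Y) ∧ dist o (a : Y) ≤ R := a.2
          refine hjk (hunique _ j k h1 h2 ?_ ?_) <;> rw [h.dist_base_dil hsk] <;> nlinarith
        dsimp only
        rw [hz, hz, SeqLp.coordL_single_of_ne hjk, sub_zero, smul_zero]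
    exact congrArg (fun T => T v) this
  exact ⟨S, T, fun x => congrArg (fun T => T x) hTS⟩

theorem exists_ne_mem_annulus {R : ℝ} (hR : 1 < R) (c : annulus o (Set.Ioc 1 R)) :
    ∃ c' : annulus o (Set.Ioc 1 R), c' ≠ c := by
  have hc : 0 < dist o (c : Y) := one_pos.trans c.2.1
  have key : ∀ r ∈ Set.Ioc 1 R, r ≠ dist o (c : Y) → ∃ c' : annulus o (Set.Ioc 1 R), c' ≠ c := by
    intro r hr hne
    have e : dist o (dil (r / dist o (c : Y)) c) = r := by
      rw [h.dist_base_dil (div_pos (one_pos.trans hr.1) hc), div_mul_cancel₀ _ hc.ne']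
    refine ⟨⟨dil (r / dist o (c : Y)) c, ?_⟩, fun h0 => hne ?_⟩
    · change dist o (dil (r / dist o (c : Y)) c) ∈ Set.Ioc 1 R
      rwa [e]
    · rw [← h0]
      exact e.symm
  by_cases hcR : R = dist o (c : Y)
  · exact key ((1 + R) / 2) ⟨by linarith, by linarith⟩ (by linarith)
  · exact key R ⟨hR, le_rfl⟩ hcR

end IsDilation

/-! ### Partition of unity in the logarithmic radius -/

/-- The `k`-th member of the partition of unity of the real line consisting of tents of
width `2 * l`. -/
def tent (l : ℝ) (k : ℤ) (t : ℝ) : ℝ := max 0 (1 - |t / l - k - 1|)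

theorem abs_tent_le (l : ℝ) (k : ℤ) (t : ℝ) : |tent l k t| ≤ 1 := by
  rw [tent, abs_of_nonneg (le_max_left _ _)]
  exact max_le zero_le_one (by linarith [abs_nonneg (t / l - k - 1)])

theorem abs_tent_sub_le {l : ℝ} (hl : 0 < l) (k : ℤ) (s t : ℝ) :
    |tent l k s - tent l k t| ≤ 1 / l * |s - t| := by
  have h1 := abs_max_zero_sub_le (1 - |s / l - k - 1|) (1 - |t / l - k - 1|)
  rw [sub_sub_sub_cancel_left] at h1
  refine h1.trans ((abs_abs_sub_abs_le_abs_sub _ _).trans_eq ?_)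
  have : t / l - k - 1 - (s / l - k - 1) = (t - s) / l := by ring
  rw [this, abs_div, abs_of_pos hl, abs_sub_comm, one_div_mul_eq_div]

theorem tent_ne_zero {l : ℝ} {k : ℤ} {t : ℝ} (h : tent l k t ≠ 0) :
    k < t / l ∧ t / l < k + 2 := by
  have h1 : |t / l - k - 1| < 1 := by
    by_contra! hle
    exact h (max_eq_left (by linarith))
  rw [abs_lt] at h1
  constructor <;> linarith

theorem tent_floor_add (l t : ℝ) : tent l ⌊t / l⌋ t + tent l (⌊t / l⌋ - 1) t = 1 := by
  have h1 := Int.floor_le (t / l)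
  have h2 := Int.lt_floor_add_one (t / l)
  rw [tent, tent, abs_of_nonpos (by linarith), abs_of_nonneg (by push_cast; linarith),
    max_eq_right (by linarith), max_eq_right (by push_cast; linarith)]
  push_cast
  ring

theorem tent_eq_zero {l : ℝ} {k : ℤ} {t : ℝ} (h1 : k ≠ ⌊t / l⌋) (h2 : k ≠ ⌊t / l⌋ - 1) :
    tent l k t = 0 := by
  by_contra h
  obtain ⟨h3, h4⟩ := tent_ne_zero h
  have h5 : k ≤ ⌊t / l⌋ := Int.le_floor.2 h3.le
  have h6 : ⌊t / l⌋ < k + 2 := Int.floor_lt.2 (by push_cast; exact h4)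
  omega

namespace IsDilation

open LipFree

variable {p : ℝ} [Fact (0 < p)] {Y : Type*} [MetricSpace Y] {o : Y} {dil : ℝ → Y → Y}
  (h : IsDilation o dil)
include h

/-- The free space over the whole space is complemented in the `ℓ_p`-sum of the free space over an
annulus. The coordinates indexed by the first copy of `ℤ` come from a partition of unity; those
indexed by the second copy restore the masses that are lost by the choice of the base point in
each annulus. -/
theorem isComplementedIn_seqLp_annulus {R : ℝ} (hR : 1 < R) (c : annulus o (Set.Ioc 1 R)) :
    IsComplementedIn (LipFree p Y o) (SeqLp p (LipFree p (annulus o (Set.Ioc 1 R)) c)) := by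
  classical
  have hp : 0 < p := Fact.out
  obtain ⟨c', hc'⟩ := h.exists_ne_mem_annulus hR c
  let E := LipFree p (annulus o (Set.Ioc 1 R)) c
  -- The `k`-th tent is then supported where s_k < d(o, x) < R s_k, exactly what brings x into the
  -- annulus after dilation by s_k⁻¹.
  let l : ℝ := Real.log R / 2
  have hl : 0 < l := half_pos (Real.log_pos hR)
  have hl2 : 2 * l = Real.log R := by ring
  have hR0 : 0 < R := one_pos.trans hR
  let s : ℤ → ℝ := fun k => Real.exp (k * l)
  have hs : ∀ k, 0 < s k := fun k => Real.exp_pos _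
  let w : ℤ → Y → ℝ := fun k => logWeight (tent l k) o
  have hw : ∀ k x, w k x ≠ 0 → s k < dist o x ∧ dil (s k)⁻¹ x ∈ annulus o (Set.Ioc 1 R) := by
    intro k x hx
    have hxo := ne_of_logWeight_ne_zero hx
    have hx0 : 0 < dist o x := dist_pos.2 hxo.symm
    have h1 := tent_ne_zero (fun e => hx ((logWeight_of_ne (tent l k) hxo).trans e))
    rw [lt_div_iff₀ hl, div_lt_iff₀ hl] at h1
    have h2 : s k < dist o x := by
      rw [← Real.log_lt_log_iff (hs k) hx0, Real.log_exp]
      exact h1.1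
    have h3 : dist o x < R * s k := by
      rw [← Real.log_lt_log_iff hx0 (mul_pos hR0 (hs k)),
        Real.log_mul hR0.ne' (hs k).ne', Real.log_exp]
      linarith [h1.2]
    refine ⟨h2, ?_⟩
    change dist o (dil (s k)⁻¹ x) ∈ Set.Ioc 1 R
    rw [h.dist_base_dil (inv_pos.2 (hs k)), inv_mul_eq_div]
    exact ⟨(one_lt_div (hs k)).2 h2, (div_le_iff₀ (hs k)).2 h3.le⟩
  have hdelta : ∀ a : annulus o (Set.Ioc 1 R), ‖delta p c a‖ ≤ (2 * R) ^ p := fun a => by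
    refine (norm_delta_le c a).trans (Real.rpow_le_rpow dist_nonneg ?_ hp.le)
    have h1 := dist_triangle_left (a : Y) c o
    have h2 := a.2.2
    have h3 := c.2.2
    rw [Subtype.dist_eq]
    linarith
  let f : ℤ ⊕ ℤ → Y → E := Sum.elim
    (fun k x => if hx : dil (s k)⁻¹ x ∈ annulus o (Set.Ioc 1 R) then s k • delta p c ⟨_, hx⟩ else 0)
    (fun k _ => s k • delta p c c')
  let v : ℤ ⊕ ℤ → Y → ℝ := Sum.elim w w
  have hfC : ∀ i x, v i x ≠ 0 → ‖f i x‖ ≤ (2 * R) ^ p * dist o x ^ p := by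
    have key : ∀ k x (a : annulus o (Set.Ioc 1 R)), w k x ≠ 0 →
        ‖s k • delta p c a‖ ≤ (2 * R) ^ p * dist o x ^ p := fun k x a hx => by
      rw [PBanachSpace.norm_smul_eq (p := p), abs_of_pos (hs k), mul_comm]
      exact mul_le_mul (hdelta a) (Real.rpow_le_rpow (hs k).le (hw k x hx).1.le hp.le)
        (Real.rpow_nonneg (hs k).le p) (by positivity)
    rintro (k | k) x hx
    · simp only [f, Sum.elim_inl]
      rw [dif_pos (hw k x hx).2]
      exact key k x _ hx
    · exact key k x _ hx
  have hfK : ∀ i x y, v i x ≠ 0 → v i y ≠ 0 → ‖f i x - f i y‖ ≤ 1 * dist x y ^ p := by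
    rintro (k | k) x y hx hy
    · simp only [f, Sum.elim_inl]
      rw [dif_pos (hw k x hx).2, dif_pos (hw k y hy).2, ← smul_sub,
        PBanachSpace.norm_smul_eq (p := p), abs_of_pos (hs k), one_mul]
      refine (mul_le_mul_of_nonneg_left (norm_delta_sub_le _ _ _)
        (Real.rpow_nonneg (hs k).le p)).trans_eq ?_
      rw [Subtype.dist_eq, h.dist_dil (inv_pos.2 (hs k)), ← Real.mul_rpow (hs k).le
        (mul_nonneg (inv_pos.2 (hs k)).le dist_nonneg), mul_inv_cancel_left₀ (hs k).ne']
    · simp only [f, Sum.elim_inr, sub_self, norm_zero, one_mul]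
      positivity
  let K : ℝ := (2 * R) ^ p * (2 * (1 / l) + 4) ^ p + 1
  have hK : 0 ≤ K := by positivity
  have hG : ∀ i x y, ‖v i x • f i x - v i y • f i y‖ ≤ K * dist x y ^ p := by
    intro i
    have h1 : ∀ k : ℤ, ∀ x, |w k x| ≤ 1 := fun k => abs_logWeight_le (abs_tent_le l k) o
    have h2 : ∀ k : ℤ, ∀ x y, |w k x - w k y| * dist o y ≤ (2 * (1 / l) + 4) * dist x y := fun k =>
      abs_logWeight_sub_mul_le (by positivity) (abs_tent_le l k) (abs_tent_sub_le hl k) o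
    refine norm_smul_sub_smul_le hp (by positivity) (by positivity) zero_le_one ?_ ?_
      (hfC i) (hfK i)
    · rcases i with k | k <;> exact h1 k
    · rcases i with k | k <;> exact h2 k
  let t : Y → Finset ℤ := fun x =>
    {⌊Real.log (dist o x) / l⌋, ⌊Real.log (dist o x) / l⌋ - 1}
  have ht : ∀ x, ∀ k ∉ t x, w k x = 0 := by
    intro x k hk
    simp only [t, Finset.mem_insert, Finset.mem_singleton, not_or] at hk
    by_contra h0
    exact h0 ((logWeight_of_ne (tent l k) (ne_of_logWeight_ne_zero h0)).trans
      (tent_eq_zero hk.1 hk.2))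
  have hv : ∀ x, ∀ i ∉ (t x).disjSum (t x), v i x = 0 := by
    rintro x (k | k) hk
    · exact ht x k (by simpa using hk)
    · exact ht x k (by simpa using hk)
  obtain ⟨e⟩ : Nonempty (ℕ ≃ ℤ ⊕ ℤ) := ⟨(Denumerable.eqv (ℤ ⊕ ℤ)).symm⟩
  -- `m = 4`: at most two active tents, each in two copies.
  obtain ⟨H, hH, hHlip⟩ := SeqLp.exists_map_of_finite_support (p := p)
    (G := fun n x => v (e n) x • f (e n) x) (m := 4) hK (fun n => hG (e n)) fun x => by
      refine ⟨((t x).disjSum (t x)).map e.symm.toEmbedding, ?_, fun n hn => ?_⟩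
      · rw [Finset.card_map, Finset.card_disjSum]
        have : (t x).card ≤ 2 := Finset.card_le_two
        omega
      · rw [hv x (e n) fun hmem => hn ?_, zero_smul]
        exact Finset.mem_map.2 ⟨e n, hmem, e.symm_apply_apply n⟩
  obtain ⟨S, hS, -⟩ := exists_lift (p := p) o (by positivity) hHlip
  -- the reconstruction operator
  have hc'c : 0 < dist c' c := dist_pos.2 hc'
  let KT : ℝ := (dist o (c : Y) / dist c' c) ^ p
  have hKT : 0 ≤ KT := by positivity
  have hT : ∀ i : ℤ ⊕ ℤ, ∃ L : E →L[ℝ] LipFree p Y o,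
      (∀ a : annulus o (Set.Ioc 1 R), L (delta p c a) = i.elim
        (fun k => (s k)⁻¹ • delta p o (dil (s k) a) - (s k)⁻¹ • delta p o (dil (s k) c))
        (fun k => ((s k)⁻¹ * (dist a c / dist c' c)) • delta p o (dil (s k) c))) ∧
      ∀ u, ‖L u‖ ≤ (1 + KT) * ‖u‖ := by
    rintro (k | k)
    · obtain ⟨L, hL, hL1⟩ := exists_lift (p := p) c
        (f := fun a : annulus o (Set.Ioc 1 R) => (s k)⁻¹ • delta p o (dil (s k) a)) zero_le_one
        fun x y => by
          rw [one_mul]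
          exact h.norm_smul_delta_dil_sub_le (hs k) o x y
      refine ⟨L, hL, fun u => (hL1 u).trans ?_⟩
      exact mul_le_mul_of_nonneg_right (by linarith) (norm_nonneg u)
    -- The function d(a, c)/d(c', c) vanishes at `c` and is 1 at `c'`, so δ(c') is sent to a
    -- multiple of δ at the dilate of `c`.
    · obtain ⟨L, hL, hL1⟩ := exists_lift (p := p) c
        (f := fun a : annulus o (Set.Ioc 1 R) =>
          ((s k)⁻¹ * (dist a c / dist c' c)) • delta p o (dil (s k) (c : Y))) hKT
        fun x y => by
          rw [← sub_smul, PBanachSpace.norm_smul_eq (p := p), ← mul_sub, ← sub_div, abs_mul,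
            abs_div, abs_of_pos (inv_pos.2 (hs k)), abs_of_pos hc'c]
          have h1 : ‖delta p o (dil (s k) (c : Y))‖ ≤ (s k * dist o (c : Y)) ^ p := by
            refine (norm_delta_le _ _).trans_eq ?_
            rw [dist_comm, h.dist_base_dil (hs k)]
          refine (mul_le_mul (Real.rpow_le_rpow (by have := hs k; positivity)
            (mul_le_mul_of_nonneg_left (div_le_div_of_nonneg_right (abs_dist_sub_le x y c) hc'c.le)
              (inv_pos.2 (hs k)).le) hp.le) h1 (norm_nonneg _)
              (by have := hs k; positivity)).trans_eq ?_
          have hsk := hs k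
          rw [← Real.mul_rpow (by positivity) (by positivity),
            ← Real.mul_rpow (by positivity) (by positivity)]
          congr 1
          field_simp
      refine ⟨L, fun a => ?_, fun u => (hL1 u).trans ?_⟩
      · rw [hL, dist_self, zero_div, mul_zero, zero_smul, sub_zero]
        rfl
      · exact mul_le_mul_of_nonneg_right (by linarith) (norm_nonneg u)
  choose L hL hL1 using hT
  obtain ⟨T, -, hT, -⟩ := SeqLp.exists_ofFamily (p := p) (fun n => L (e n)) fun n => hL1 (e n)
  -- The first copy returns w_k(x)(δ(x) - δ(s_k c)), since δ(c) = 0 in the free space over the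
  -- annulus; the second returns the missing w_k(x) δ(s_k c).
  have hrec : ∀ k x, L (.inl k) (v (.inl k) x • f (.inl k) x) +
      L (.inr k) (v (.inr k) x • f (.inr k) x) = w k x • delta p o x := by
    intro k x
    simp only [v, f, Sum.elim_inl, Sum.elim_inr]
    by_cases hx : w k x = 0
    · rw [hx, zero_smul, zero_smul, zero_smul, map_zero, map_zero, add_zero]
    · rw [dif_pos (hw k x hx).2, map_smul, map_smul, map_smul, map_smul, hL, hL, Sum.elim_inl,
        Sum.elim_inr, div_self hc'c.ne', mul_one, h.dil_dil_inv (hs k), ← smul_sub,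
        smul_inv_smul₀ (hs k).ne', smul_inv_smul₀ (hs k).ne', ← smul_add, sub_add_cancel]
  have hTH : ∀ x, T (H x) = delta p o x := by
    intro x
    rw [hT]
    simp only [hH]
    rw [e.tsum_eq (fun i => L i (v i x • f i x)), tsum_eq_sum (s := (t x).disjSum (t x))]
    · rw [Finset.sum_disjSum, ← Finset.sum_add_distrib, Finset.sum_congr rfl fun k _ => hrec k x,
        ← Finset.sum_smul]
      rcases eq_or_ne x o with rfl | hx
      · rw [delta_base, smul_zero]
      · rw [Finset.sum_pair (by omega)]
        simp only [w]
        rw [logWeight_of_ne _ hx, logWeight_of_ne _ hx, tent_floor_add, one_smul]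
    · intro i hi
      rw [hv x i hi, zero_smul, map_zero]
  have hTS : T.comp S = ContinuousLinearMap.id ℝ _ := LipFree.clm_ext fun x => by
    rw [ContinuousLinearMap.comp_apply, hS, map_sub, hTH, hTH, delta_base, sub_zero,
      ContinuousLinearMap.id_apply]
  exact ⟨S, T, fun x => congrArg (fun T => T x) hTS⟩

theorem nonempty_equiv_seqLp_annulus {R : ℝ} (hR : 1 < R) (c : annulus o (Set.Ioc 1 R)) :
    Nonempty (LipFree p Y o ≃L[ℝ] SeqLp p (LipFree p (annulus o (Set.Ioc 1 R)) c)) ∧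
    Nonempty (LipFree p (unitBall o) ⟨o, mem_unitBall_self o⟩ ≃L[ℝ]
      SeqLp p (LipFree p (annulus o (Set.Ioc 1 R)) c)) ∧
    ∀ b : ((unitBall o)ᶜ : Set Y), Nonempty (LipFree p ((unitBall o)ᶜ : Set Y) b ≃L[ℝ]
      SeqLp p (LipFree p (annulus o (Set.Ioc 1 R)) c)) := by
  have hp : 0 < p := Fact.out
  have hY := h.isComplementedIn_seqLp_annulus (p := p) hR c
  have hB := h.isComplementedIn_unitBall (p := p)
  have hq : 1 < 4 * R := by linarith
  have hq0 : 0 < 4 * R := by linarith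
  have hpow : ∀ j k : ℕ, j < k → 4 * R * (4 * R) ^ j ≤ (4 * R) ^ k := fun j k hjk => by
    rw [← pow_succ']
    exact pow_le_pow_right₀ hq.le hjk
  have hSB : IsComplementedIn (SeqLp p (LipFree p (annulus o (Set.Ioc 1 R)) c))
      (LipFree p (unitBall o) ⟨o, mem_unitBall_self o⟩) := by
    -- The exponent `k + 1` puts even the zeroth dilate inside the ball: its radii are at most
    -- R/(4R).
    refine h.isComplementedIn_of_sparse hR c (s := fun k => ((4 * R) ^ (k + 1))⁻¹)
      (fun k => by positivity) (fun j k hjk => ?_) _ fun k a ha => ?_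
    · have key : ∀ j k : ℕ, j < k → 4 * R * ((4 * R) ^ (k + 1))⁻¹ ≤ ((4 * R) ^ (j + 1))⁻¹ := by
        intro j k hjk
        rw [← div_eq_mul_inv, div_le_iff₀ (by positivity), inv_mul_eq_div,
          le_div_iff₀ (by positivity)]
        exact hpow (j + 1) (k + 1) (by omega)
      rcases lt_or_gt_of_ne hjk with hjk | hjk
      · exact Or.inr (key j k hjk)
      · exact Or.inl (key k j hjk)
    · change dist o (dil ((4 * R) ^ (k + 1))⁻¹ a) ≤ 1
      have ha2 : dist o a ≤ R := ha.2
      rw [h.dist_base_dil (by positivity), inv_mul_le_iff₀ (by positivity), mul_one]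
      have h1 := hpow 0 (k + 1) (by omega)
      rw [pow_zero, mul_one] at h1
      linarith
  refine ⟨hY.nonempty_equiv hp (hSB.trans hB), (hB.trans hY).nonempty_equiv hp hSB, fun b => ?_⟩
  refine ((h.isComplementedIn_compl_unitBall b).trans hY).nonempty_equiv hp ?_
  refine h.isComplementedIn_of_sparse hR c (s := fun k => (4 * R) ^ k)
    (fun k => by positivity) (fun j k hjk => ?_) _ fun k a ha => ?_
  · rcases lt_or_gt_of_ne hjk with hjk | hjk
    · exact Or.inl (hpow j k hjk)
    · exact Or.inr (hpow k j hjk)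
  · intro hle
    change dist o (dil ((4 * R) ^ k) a) ≤ 1 at hle
    have ha1 : 1 < dist o a := ha.1
    rw [h.dist_base_dil (by positivity)] at hle
    have h1 : 1 ≤ (4 * R) ^ k := one_le_pow₀ hq.le
    nlinarith

end IsDilation

/-! ### Snowflakes of cones -/

/-- The dilation of the snowflake of a cone that multiplies distances by `s`. -/
def snowDil {X : Type*} [NormedAddCommGroup X] [NormedSpace ℝ X] {α : ℝ} {hα₀ : 0 < α}
    {hα₁ : α ≤ 1} {M : Set X} (hM : ∀ t : ℝ, 0 ≤ t → ∀ x ∈ M, t • x ∈ M) (s : ℝ)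
    (x : Metric.Snowflaking M α hα₀ hα₁) : Metric.Snowflaking M α hα₀ hα₁ :=
  Metric.Snowflaking.toSnowflaking ⟨|s| ^ (1 / α) • ((Metric.Snowflaking.ofSnowflaking x : M) : X),
    hM _ (by positivity) _ (Metric.Snowflaking.ofSnowflaking x).2⟩

theorem snow_dist_eq {X : Type*} [NormedAddCommGroup X] {α : ℝ} {hα₀ : 0 < α}
    {hα₁ : α ≤ 1} {M : Set X} (x y : Metric.Snowflaking M α hα₀ hα₁) :
    dist x y =
      ‖((Metric.Snowflaking.ofSnowflaking x : M) : X) - (Metric.Snowflaking.ofSnowflaking y : M)‖ ^ α := by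
  rw [← dist_eq_norm, ← Subtype.dist_eq]
  rfl

/-- The one geometric axiom, `dist_dil_self_le`, is the reverse triangle inequality: with λ = s ^
(1/α) and ‖z‖ ≤ λ‖u‖, one has ‖u - λu‖ = (1 - λ)‖u‖ ≤ ‖u‖ - ‖z‖ ≤ ‖u - z‖. Raising to the power α
keeps the constant 1. -/
theorem isDilation_snowDil {X : Type*} [NormedAddCommGroup X] [NormedSpace ℝ X] {α : ℝ}
    (hα₀ : 0 < α) (hα₁ : α ≤ 1) {M : Set X} (h0 : (0 : X) ∈ M)
    (hM : ∀ t : ℝ, 0 ≤ t → ∀ x ∈ M, t • x ∈ M) :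
    IsDilation (snowZero h0 hα₀ hα₁) (snowDil hM) where
  dil_one x := by
    refine Metric.Snowflaking.ofSnowflaking.injective (Subtype.ext ?_)
    simp [snowDil]
  dil_dil := fun {s t} hs ht x => by
    refine Metric.Snowflaking.ofSnowflaking.injective (Subtype.ext ?_)
    simp [snowDil, smul_smul, abs_mul, Real.mul_rpow]
  dil_base s := by
    refine Metric.Snowflaking.ofSnowflaking.injective (Subtype.ext ?_)
    simp [snowDil, snowZero]
  dist_dil := fun {s} hs x y => by
    rw [snow_dist_eq, snow_dist_eq]
    simp only [snowDil, Metric.Snowflaking.ofSnowflaking_toSnowflaking]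
    rw [← smul_sub, norm_smul, Real.mul_rpow (norm_nonneg _) (norm_nonneg _),
      Real.norm_of_nonneg (by positivity), ← Real.rpow_mul (abs_nonneg s),
      one_div_mul_cancel hα₀.ne', Real.rpow_one, abs_of_pos hs]
  dist_dil_self_le := fun {s} hs hs1 x y hxy => by
    rw [snow_dist_eq, snow_dist_eq] at *
    simp only [snowDil, snowZero, Metric.Snowflaking.ofSnowflaking_toSnowflaking, zero_sub,
      norm_neg] at *
    set u : X := ((Metric.Snowflaking.ofSnowflaking x : M) : X)
    set z : X := ((Metric.Snowflaking.ofSnowflaking y : M) : X)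
    rw [abs_of_pos hs]
    have hr : s = (s ^ (1 / α)) ^ α := by
      rw [← Real.rpow_mul hs.le, one_div_mul_cancel hα₀.ne', Real.rpow_one]
    have hr1 : s ^ (1 / α) ≤ 1 := Real.rpow_le_one hs.le hs1 (by positivity)
    have hr0 : 0 ≤ s ^ (1 / α) := by positivity
    rw [hr, ← Real.mul_rpow hr0 (norm_nonneg _),
      Real.rpow_le_rpow_iff (norm_nonneg _) (by positivity) hα₀] at hxy
    refine Real.rpow_le_rpow (norm_nonneg _) ?_ hα₀.le
    have e : u - s ^ (1 / α) • u = (1 - s ^ (1 / α)) • u := by rw [sub_smul, one_smul]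
    rw [e, norm_smul, Real.norm_of_nonneg (by linarith)]
    have := norm_sub_norm_le u z
    linarith
  tendsto_dil x := by
    refine Tendsto.mono_left ?_ nhdsWithin_le_nhds
    have hc : ContinuousAt (fun s : ℝ => |s| ^ (1 / α) •
        ((Metric.Snowflaking.ofSnowflaking x : M) : X)) 1 :=
      (continuous_abs.continuousAt.rpow_const (Or.inl (by simp))).smul continuousAt_const
    have h1 : Tendsto (fun s : ℝ => Metric.Snowflaking.ofSnowflaking (snowDil hM s x)) (𝓝 1)
        (𝓝 (Metric.Snowflaking.ofSnowflaking x)) := by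
      rw [tendsto_subtype_rng]
      have h2 := hc.tendsto
      rw [abs_one, Real.one_rpow, one_smul] at h2
      exact h2
    exact (Metric.Snowflaking.continuous_toSnowflaking.tendsto _).comp h1

theorem LipFree.eq_zero_of_subsingleton {p : ℝ} [Fact (0 < p)] {Y : Type*} [MetricSpace Y]
    [Subsingleton Y] (o : Y) (x : LipFree p Y o) : x = 0 := by
  have : ContinuousLinearMap.id ℝ (LipFree p Y o) = 0 := clm_ext fun y => by
    rw [Subsingleton.elim y o, delta_base, map_zero, map_zero]
  exact congrArg (fun T => T x) this

theorem Isomorphic.of_subsingleton {p : ℝ} [Fact (0 < p)] {Y Z : Type*} [MetricSpace Y]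
    [MetricSpace Z] [Subsingleton Y] [Subsingleton Z] (y : Y) (z : Z) :
    Isomorphic p (LipFree p Y y) (LipFree p Z z) :=
  PBanachSpace.isomorphic_of_equiv Fact.out (ContinuousLinearEquiv.equivOfInverse 0 0
    (fun x => (LipFree.eq_zero_of_subsingleton y x).symm)
    fun x => (LipFree.eq_zero_of_subsingleton z x).symm)

end

theorem theorem4 {X : Type*} [NormedAddCommGroup X] [NormedSpace ℝ X] [CompleteSpace X]
    (p : ℝ) [Fact (0 < p)] (hp : p ≤ 1) (α : ℝ) (hα₀ : 0 < α) (hα₁ : α ≤ 1)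
    (R : ℝ) (hR : 1 < R)
    (M : Set X) (h0 : (0 : X) ∈ M) (hM : ∀ t : ℝ, 0 ≤ t → ∀ x ∈ M, t • x ∈ M) :
    -- `M` carries the metric `‖x - y‖ ^ α` and the base point `0`
    Isomorphic p (LipFree p (Metric.Snowflaking M α hα₀ hα₁) (snowZero h0 hα₀ hα₁))
      (LipFree p (unitBall (snowZero h0 hα₀ hα₁)) ⟨snowZero h0 hα₀ hα₁, mem_unitBall_self _⟩) ∧
    -- the base points `b`, `c` of the sets that do not contain `0` are arbitrary
    ∀ b : ((unitBall (snowZero h0 hα₀ hα₁))ᶜ : Set (Metric.Snowflaking M α hα₀ hα₁)),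
      Isomorphic p
        (LipFree p (unitBall (snowZero h0 hα₀ hα₁)) ⟨snowZero h0 hα₀ hα₁, mem_unitBall_self _⟩)
        (LipFree p ((unitBall (snowZero h0 hα₀ hα₁))ᶜ :
          Set (Metric.Snowflaking M α hα₀ hα₁)) b) ∧
      ∀ c : annulus (snowZero h0 hα₀ hα₁) (Set.Ioc 1 R),
        Isomorphic p
          (LipFree p ((unitBall (snowZero h0 hα₀ hα₁))ᶜ :
            Set (Metric.Snowflaking M α hα₀ hα₁)) b)
          (SeqLp p (LipFree p (annulus (snowZero h0 hα₀ hα₁) (Set.Ioc 1 R)) c)) := by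
  have hp0 : 0 < p := Fact.out
  have h := isDilation_snowDil hα₀ hα₁ h0 hM
  have hc : ∀ x, x ≠ snowZero h0 hα₀ hα₁ →
      Nonempty (annulus (snowZero h0 hα₀ hα₁) (Set.Ioc 1 R)) := by
    intro x hx
    have hx0 := dist_pos.2 hx.symm
    refine ⟨⟨snowDil hM (R / dist (snowZero h0 hα₀ hα₁) x) x, ?_⟩⟩
    change dist _ (snowDil hM _ x) ∈ Set.Ioc 1 R
    rw [h.dist_base_dil (div_pos (by linarith) hx0), div_mul_cancel₀ _ hx0.ne']
    exact ⟨hR, le_rfl⟩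
  refine ⟨?_, fun b => ⟨?_, fun c => ?_⟩⟩
  · by_cases hx : ∃ x, x ≠ snowZero h0 hα₀ hα₁
    · obtain ⟨x, hx⟩ := hx
      obtain ⟨c⟩ := hc x hx
      obtain ⟨⟨e⟩, ⟨f⟩, -⟩ := h.nonempty_equiv_seqLp_annulus (p := p) hR c
      exact PBanachSpace.isomorphic_of_equiv hp0 (e.trans f.symm)
    -- For M = {0} the annulus is empty and has no base point; both free spaces are zero.
    · push Not at hx
      have : Subsingleton (Metric.Snowflaking M α hα₀ hα₁) :=
        ⟨fun x y => (hx x).trans (hx y).symm⟩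
      exact Isomorphic.of_subsingleton _ _
  · obtain ⟨c⟩ := hc b fun e => b.2 (by rw [e]; exact mem_unitBall_self _)
    obtain ⟨-, ⟨f⟩, g⟩ := h.nonempty_equiv_seqLp_annulus (p := p) hR c
    obtain ⟨g⟩ := g b
    exact PBanachSpace.isomorphic_of_equiv hp0 (f.trans g.symm)
  · obtain ⟨-, -, g⟩ := h.nonempty_equiv_seqLp_annulus (p := p) hR c
    obtain ⟨g⟩ := g b
    exact PBanachSpace.isomorphic_of_equiv hp0 g
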